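/- Let $n\ge 3$ and $m\ge 2$ be integers and let $\beta\in[0,1)$. Let $P$ be the nearest-neighbour random walk on the $n$-cycle $\mathbb Z/n\mathbb Z$ with holding probability $\beta$, that is, $P(x,x)=\beta$ and $P(x,x\pm1)=(1-\beta)/2$; if $\beta=0$ (simple random walk), assume that $n$ is odd, so that the walk is aperiodic. The $m$-state lamplighter chain over $P$ has state space $\mathcal X=\{0,\dots,m-1\}^{\mathbb Z/n\mathbb Z}\times\mathbb Z/n\mathbb Z$ (lamp configuration, position of the lamplighter). In each step the lamp at the current position is replaced by an independent uniform element of $\{0,\dots,m-1\}$, the lamplighter moves according to $P$, and then the lamp at the new position is randomized in the same way. Let $\mathbb P$ be its transition matrix, let $\pi$ be the uniform distribution on $\mathcal X$, $\pi_*=\min_x\pi(x)$, and $N=m^n$. For $0<\varepsilon<1/2$ let $\tau_{\rm tv}(\varepsilon)$, $\tau_{\rm ent}(\varepsilon)$, $\tau_2(\varepsilon)$ be the least $t$ such that for all $s\ge t$ and all $x\in\mathcal X$, respectively, $$\sum_{y:\,\pi(y)>\mathbb P^s(x,y)}(\pi(y)-\mathbb P^s(x,y))\le\varepsilon,\qquad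 \sum_y \mathbb P^s(x,y)\log\frac{\mathbb P^s(x,y)}{\pi(y)}\le\varepsilon,\qquad \Bigl(\sum_y\Bigl(\frac{\mathbb P^s(x,y)}{\pi(y)}-1\Bigr)^2\pi(y)\Bigr)^{1/2}\le\varepsilon .$$ Then $\mathbb P$ is a reversible Markov chain with stationary distribution $\pi$. For all fixed $\beta\in[0,1)$ and $\varepsilon\in(0,1/2)$ the following hold, where the constants $c,C>0$ depend only on $\beta$ and $\varepsilon$ (not on $n$ or $m$): 1. $c\,n^2\le\tau_{\rm tv}(\varepsilon)\le C\,n^2$; 2. $c\,n^2\log(n\log m)\le\tau_{\rm ent}(\varepsilon)\le C\,n^2\log(n\log m)$; 3. $\tau_2(\varepsilon)\ge c\,n^2\log N$; 4. $\tau_{\rm ent}(\varepsilon)\ge c\,\tau_{\rm tv}\bigl(\tfrac1{2e}\bigr)\bigl[\log\log(1/\pi_*)+\log(1/\varepsilon)\bigr]$. That is, the factor $\log\log(1/\pi_*)$ in the general bound $\tau_{\rm ent}(\varepsilon)\le C'\,\tau_{\rm tv}(\tfrac1{2e})[\log\log(1/\pi_*)+\log(1/\varepsilon)]$ for reversible chains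 is tight; 5. the three mixing times have different orders of magnitude: $\tau_{\rm ent}(\varepsilon)/\tau_{\rm tv}(\varepsilon)\to\infty$ and $\tau_2(\varepsilon)/\tau_{\rm ent}(\varepsilon)\to\infty$ as $N=m^n\to\infty$ (uniformly over all admissible pairs $(n,m)$). -/

import Mathlib

noncomputable section

namespace Lamplighter

section Mixing

variable {X : Type*} [Fintype X] [DecidableEq X]

/-- The uniform distribution on a finite set. -/
def uniform (X : Type*) [Fintype X] : X → ℝ := fun _ => 1 / (Fintype.card X : ℝ)

/-- The smallest value `π_*` of a distribution `π`. -/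
def minMass (π : X → ℝ) : ℝ := ⨅ x, π x

/-- Detailed balance of the transition matrix `P` with respect to `π`. -/
def IsReversible (P : Matrix X X ℝ) (π : X → ℝ) : Prop :=
  ∀ x y, π x * P x y = π y * P y x

/-- Total variation distance: the sum of `π y - μ y` over all `y` with `π y > μ y`. -/
def tvDist (μ π : X → ℝ) : ℝ := ∑ y with μ y < π y, (π y - μ y)

/-- The `L²(π)` norm of `μ / π - 1`. -/
def l2Dist (μ π : X → ℝ) : ℝ := Real.sqrt (∑ y, (μ y / π y - 1) ^ 2 * π y)

/-- Relative entropy `D(μ ‖ π)`, with `0 log 0 = 0`. -/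
def relEntropy (μ π : X → ℝ) : ℝ := ∑ y, μ y * Real.log (μ y / π y)

/-- The mixing time with respect to a discrepancy `d`: the least `t` such that
`d (P ^ s (x, ·)) π ≤ ε` for all `s ≥ t` and all starting states `x`. -/
def mixingTime (d : (X → ℝ) → (X → ℝ) → ℝ) (P : Matrix X X ℝ) (π : X → ℝ) (ε : ℝ) : ℕ :=
  sInf {t : ℕ | ∀ s : ℕ, t ≤ s → ∀ x : X, d ((P ^ s) x) π ≤ ε}

end Mixing

section Chain

variable {V : Type*} [Fintype V] [DecidableEq V]

/-- States of the lamplighter chain with `m`-state lamps: a lamp configuration together with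
the position of the lamplighter. -/
abbrev State (V : Type*) (m : ℕ) : Type _ := (V → Fin m) × V

/-- Complete randomization of the lamp at the current position. -/
def randomizeLamp (V : Type*) [Fintype V] [DecidableEq V] (m : ℕ) :
    Matrix (State V m) (State V m) ℝ :=
  fun s s' => if s.2 = s'.2 ∧ ∀ v, v ≠ s.2 → s.1 v = s'.1 v then 1 / (m : ℝ) else 0

/-- A step of the lamplighter according to `P`, with the lamps unchanged. -/
def moveStep (P : Matrix V V ℝ) (m : ℕ) : Matrix (State V m) (State V m) ℝ :=
  fun s s' => if s.1 = s'.1 then P s.2 s'.2 else 0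

/-- The lamplighter chain with `m`-state lamps over the base chain `P`: randomize the lamp at
the current position, move according to `P`, randomize the lamp at the new position. -/
def lamplighterChain (P : Matrix V V ℝ) (m : ℕ) : Matrix (State V m) (State V m) ℝ :=
  randomizeLamp V m * moveStep P m * randomizeLamp V m

/-- The nearest-neighbour walk on the `n`-cycle with holding probability `β`
(`β = 0` is simple random walk, `β = 1/2` is lazy simple random walk). -/
def cycleWalk (n : ℕ) (β : ℝ) : Matrix (ZMod n) (ZMod n) ℝ :=
  fun x y => (if y = x then β else 0) + (if y = x + 1 then (1 - β) / 2 else 0)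
    + (if y = x - 1 then (1 - β) / 2 else 0)

end Chain

section Cycle

variable (n m : ℕ) [NeZero n] (β : ℝ)

/-- The lamplighter chain on the `n`-cycle with `m`-state lamps. -/
def cycleLamp : Matrix (State (ZMod n) m) (State (ZMod n) m) ℝ :=
  lamplighterChain (cycleWalk n β) m

/-- The stationary (uniform) distribution of the lamplighter chain on the `n`-cycle. -/
def cyclePi : State (ZMod n) m → ℝ := uniform (State (ZMod n) m)

/-- Total variation mixing time of the lamplighter chain on the `n`-cycle. -/
def tauTv (ε : ℝ) : ℕ := mixingTime tvDist (cycleLamp n m β) (cyclePi n m) ε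

/-- Entropy mixing time of the lamplighter chain on the `n`-cycle. -/
def tauEnt (ε : ℝ) : ℕ := mixingTime relEntropy (cycleLamp n m β) (cyclePi n m) ε

/-- `L²` mixing time of the lamplighter chain on the `n`-cycle. -/
def tauTwo (ε : ℝ) : ℕ := mixingTime l2Dist (cycleLamp n m β) (cyclePi n m) ε

end Cycle

end Lamplighter

end

namespace Lamplighter

open Matrix

noncomputable section

/-! ### The lamplighter step seen as averaging over randomized lamps. -/

section Averaging

variable {V : Type*} [Fintype V] [DecidableEq V] {m : ℕ}

/-! Everything happens on the time scale n², in which the walk both mixes and covers the cycle; the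
three distances differ in how strongly they weigh the event that many lamps are still untouched.

Upper bounds. By `avgOn_lamplighterChain`, a configuration that is uniform on a set S of lamps stays
so while S grows along the path. Lifted to ℤ, the walk leaves (-n, n) within order n² steps with
probability at least 1/2 (`le_avgOn_pow`, through a Dirichlet eigenfunction), and then every lamp is
uniform; order n² further steps bring the position within a factor 2 of uniform from below
(`cycleWalk_pow_apply_ge`, by Fourier analysis). Hence the chain dominates π/4 after A n² steps
(`exists_minorization`), and symmetry turns this into (1 - (3/4)^k) π after k rounds. A constant k
settles total variation. Relative entropy is then at most (3/4)^k times log |𝒳|, which is of order n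
log m, so k of order log (n log m) suffices.

Lower bounds. The function cos (2πx/n) of the position forces time of order n² in all three
distances. The decisive test is the event that the lamps on an arc J of at least n/3 sites still
show their initial values. A second Dirichlet eigenfunction gives it probability at least
exp(-40t/n²)/2 (`exp_le_sum_agreeOn_farArc`), against m^(-|J|) under π. By Donsker–Varadhan, small
entropy requires this probability to be O(1/(n log m)), so t is at least of order n² log (n log m);
by Cauchy–Schwarz, small L² distance requires it to be O(m^(-|J|/2)), so t is at least of order n² ·
n log m. With X = n log m = log N the orders are n², n² log X and at least n² X, which also yields
the separation and the tightness of the iterated logarithm. -/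

lemma randomizeLamp_mulVec (F : State V m → ℝ) (g : V → Fin m) (y : V) :
    (randomizeLamp V m *ᵥ F) (g, y) =
      (m : ℝ)⁻¹ * ∑ i : Fin m, F (Function.update g y i, y) := by
  simp only [mulVec, dotProduct, randomizeLamp, ite_mul, zero_mul]
  rw [← Finset.sum_filter, Finset.mul_sum]
  refine Finset.sum_bij' (fun s _ => s.1 y) (fun i _ => (Function.update g y i, y))
    ?_ ?_ ?_ ?_ ?_
  · simp
  · intro i _
    simp +contextual [Function.update_of_ne]
  · rintro ⟨g', z⟩ h
    simp only [Finset.mem_filter, Finset.mem_univ, true_and] at h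
    obtain ⟨rfl, h⟩ := h
    refine Prod.ext (funext fun v => ?_) rfl
    by_cases hv : v = y
    · subst hv; simp
    · simp [hv, h v hv]
  · simp
  · rintro ⟨g', z⟩ h
    simp only [Finset.mem_filter, Finset.mem_univ, true_and] at h
    obtain ⟨rfl, h⟩ := h
    have : Function.update g y (g' y) = g' := by
      funext v
      by_cases hv : v = y
      · subst hv; simp
      · simp [hv, h v hv]
    simp [this]

lemma moveStep_mulVec (P : Matrix V V ℝ) (F : State V m → ℝ) (g : V → Fin m) (y : V) :
    (moveStep P m *ᵥ F) (g, y) = ∑ z, P y z * F (g, z) := by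
  simp [mulVec, dotProduct, moveStep, Fintype.sum_prod_type]

/-- Average of a function of the lamp configuration over the lamps in `S`. -/
def avgOn (S : Finset V) (φ : (V → Fin m) → ℝ) (g : V → Fin m) : ℝ :=
  ((m : ℝ) ^ Fintype.card V)⁻¹ * ∑ h : V → Fin m, φ (S.piecewise h g)

lemma avgOn_const_of_forall [NeZero m] {S : Finset V} {φ : (V → Fin m) → ℝ} {g : V → Fin m}
    {a : ℝ} (h : ∀ h : V → Fin m, φ (S.piecewise h g) = a) : avgOn S φ g = a := by
  have : (m : ℝ) ≠ 0 := Nat.cast_ne_zero.2 (NeZero.ne m)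
  simp [avgOn, h, this]

lemma avgOn_empty [NeZero m] (φ : (V → Fin m) → ℝ) (g : V → Fin m) : avgOn ∅ φ g = φ g :=
  avgOn_const_of_forall (by simp)

lemma avgOn_nonneg {S : Finset V} {φ : (V → Fin m) → ℝ} (h : ∀ g, 0 ≤ φ g) (g : V → Fin m) :
    0 ≤ avgOn S φ g :=
  mul_nonneg (by positivity) (Finset.sum_nonneg fun _ _ => h _)

lemma avgOn_sum {S : Finset V} (P : V → ℝ) (φ : V → (V → Fin m) → ℝ) (g : V → Fin m) :
    avgOn S (fun g => ∑ z, P z * φ z g) g = ∑ z, P z * avgOn S (φ z) g := by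
  simp only [avgOn, Finset.mul_sum]
  rw [Finset.sum_comm]
  refine Finset.sum_congr rfl fun _ _ => Finset.sum_congr rfl fun _ _ => by ring

lemma sum_sum_update (φ : (V → Fin m) → ℝ) (y : V) :
    ∑ h : V → Fin m, ∑ i, φ (Function.update h y i) = m * ∑ h, φ h := by
  have : ∑ p : (V → Fin m) × Fin m, φ (Function.update p.1 y p.2)
      = ∑ p : (V → Fin m) × Fin m, φ p.1 := by
    -- Exchanging the value at `y` with the fresh value is an involution of the pairs.
    refine Finset.sum_bij' (fun p _ => (Function.update p.1 y p.2, p.1 y))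
      (fun p _ => (Function.update p.1 y p.2, p.1 y)) ?_ ?_ ?_ ?_ ?_ <;> simp
  rw [Fintype.sum_prod_type, Fintype.sum_prod_type] at this
  simpa [Finset.mul_sum] using this

/-- Lamps in S are already independent and uniform, so resampling the lamp at `y` gives uniform
lamps on `insert y S`, whether or not `y` was in S. -/
lemma avgOn_update [NeZero m] (S : Finset V) (φ : (V → Fin m) → ℝ) (g : V → Fin m) (y : V) :
    avgOn S (fun g => (m : ℝ)⁻¹ * ∑ i, φ (Function.update g y i)) g = avgOn (insert y S) φ g := by
  have hm : (m : ℝ) ≠ 0 := Nat.cast_ne_zero.2 (NeZero.ne m)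
  have h1 : ∀ (h : V → Fin m) (i : Fin m), Function.update (S.piecewise h g) y i
      = (insert y S).piecewise (Function.update h y i) g := by
    intro h i
    funext v
    by_cases hv : v = y
    · subst hv; simp
    · by_cases hS : v ∈ S <;> simp [hv, hS, Finset.piecewise]
  have := sum_sum_update (fun h => φ ((insert y S).piecewise h g)) y
  simp only [avgOn, h1, ← Finset.mul_sum, this]
  field_simp

lemma lamplighterChain_mulVec (P : Matrix V V ℝ) (F : State V m → ℝ) (g : V → Fin m) (y : V) :
    (lamplighterChain P m *ᵥ F) (g, y) = (m : ℝ)⁻¹ * ∑ i, ∑ z, P y z *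
      ((m : ℝ)⁻¹ * ∑ j, F (Function.update (Function.update g y i) z j, z)) := by
  simp only [lamplighterChain, ← mulVec_mulVec, randomizeLamp_mulVec, moveStep_mulVec]

/-- One step of the lamplighter chain started from a configuration randomized on `S`. -/
lemma avgOn_lamplighterChain [NeZero m] (P : Matrix V V ℝ) (F : State V m → ℝ) (S : Finset V)
    (g : V → Fin m) (y : V) :
    avgOn S (fun g => (lamplighterChain P m *ᵥ F) (g, y)) g =
      ∑ z, P y z * avgOn (insert z (insert y S)) (fun g => F (g, z)) g := by
  simp only [lamplighterChain_mulVec]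
  rw [avgOn_update S (fun g => ∑ z, P y z *
      ((m : ℝ)⁻¹ * ∑ j, F (Function.update g z j, z))) g y, avgOn_sum]
  refine Finset.sum_congr rfl fun z _ => ?_
  rw [avgOn_update (insert y S) (fun g => F (g, z)) g z]

lemma lamplighterChain_mulVec_eq [NeZero m] (P : Matrix V V ℝ) (F : State V m → ℝ)
    (g : V → Fin m) (y : V) :
    (lamplighterChain P m *ᵥ F) (g, y) =
      ∑ z, P y z * avgOn (insert z {y}) (fun g => F (g, z)) g := by
  have := avgOn_lamplighterChain P F ∅ g y
  rwa [avgOn_empty] at this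

/-- The lamplighter chain acts on functions of the position through the base chain. -/
lemma lamplighterChain_mulVec_position [NeZero m] (P : Matrix V V ℝ) (f : V → ℝ) :
    lamplighterChain P m *ᵥ (fun s => f s.2) = fun s => (P *ᵥ f) s.2 := by
  funext ⟨g, y⟩
  rw [lamplighterChain_mulVec_eq]
  exact Finset.sum_congr rfl fun z _ => by
    rw [avgOn_const_of_forall (a := f z) fun _ => rfl]

/-- Averaging over all lamps intertwines the lamplighter chain with the base chain. -/
lemma avgOn_univ_pow [NeZero m] (P : Matrix V V ℝ) (F : State V m → ℝ) (g : V → Fin m)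
    (t : ℕ) : ∀ y,
    avgOn Finset.univ (fun g => ((lamplighterChain P m ^ t) *ᵥ F) (g, y)) g =
      ((P ^ t) *ᵥ fun z => avgOn Finset.univ (fun g => F (g, z)) g) y := by
  induction t with
  | zero => simp
  | succ t ih =>
    intro y
    simp only [pow_succ', ← mulVec_mulVec]
    rw [avgOn_lamplighterChain]
    refine Finset.sum_congr rfl fun z _ => ?_
    rw [← ih z]
    simp

lemma randomizeLamp_transpose : (randomizeLamp V m)ᵀ = randomizeLamp V m := by
  ext ⟨f, x⟩ ⟨g, y⟩
  simp only [transpose_apply, randomizeLamp]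
  congr 1
  simp only [eq_iff_iff]
  constructor <;> rintro ⟨rfl, h⟩ <;> exact ⟨rfl, fun v hv => (h v hv).symm⟩

lemma moveStep_transpose {V : Type*} [Fintype V] {P : Matrix V V ℝ} (hP : Pᵀ = P) :
    (moveStep P m)ᵀ = moveStep P m := by
  ext ⟨f, x⟩ ⟨g, y⟩
  simp only [transpose_apply, moveStep, eq_comm (a := g)]
  rw [← transpose_apply P, hP]

lemma lamplighterChain_transpose {P : Matrix V V ℝ} (hP : Pᵀ = P) :
    (lamplighterChain P m)ᵀ = lamplighterChain P m := by
  simp only [lamplighterChain, transpose_mul, randomizeLamp_transpose, moveStep_transpose hP,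
    Matrix.mul_assoc]

lemma randomizeLamp_mem_rowStochastic [NeZero m] :
    randomizeLamp V m ∈ rowStochastic ℝ (State V m) := by
  have hm : (m : ℝ) ≠ 0 := Nat.cast_ne_zero.2 (NeZero.ne m)
  refine ⟨fun s s' => ?_, ?_⟩
  · unfold randomizeLamp; split_ifs <;> positivity
  · funext ⟨g, y⟩
    rw [randomizeLamp_mulVec]
    simp [hm]

lemma moveStep_mem_rowStochastic {P : Matrix V V ℝ} (hP : P ∈ rowStochastic ℝ V) :
    moveStep P m ∈ rowStochastic ℝ (State V m) := by
  refine ⟨fun s s' => ?_, ?_⟩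
  · unfold moveStep; split_ifs
    · exact hP.1 _ _
    · exact le_rfl
  · funext ⟨g, y⟩
    rw [moveStep_mulVec]
    exact congrFun hP.2 y

lemma lamplighterChain_mem_rowStochastic [NeZero m] {P : Matrix V V ℝ}
    (hP : P ∈ rowStochastic ℝ V) : lamplighterChain P m ∈ rowStochastic ℝ (State V m) :=
  mul_mem (mul_mem randomizeLamp_mem_rowStochastic (moveStep_mem_rowStochastic hP))
    randomizeLamp_mem_rowStochastic

end Averaging

/-! ### Test-function lower bounds and minorization upper bounds for the three distances. -/

section Discrepancy

variable {X : Type*} [Fintype X]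

lemma sum_uniform [Nonempty X] : ∑ x, uniform X x = 1 := by
  simp [uniform]

lemma uniform_pos [Nonempty X] (x : X) : 0 < uniform X x := by
  simp [uniform, Fintype.card_pos]

lemma sum_abs_sub_eq_two_mul_tvDist {μ π : X → ℝ} (h : ∑ x, μ x = ∑ x, π x) :
    ∑ x, |μ x - π x| = 2 * tvDist μ π := by
  have h0 : ∑ x, (μ x - π x) = 0 := by simp [h]
  have h1 := Finset.sum_filter_add_sum_filter_not Finset.univ (fun x => μ x < π x)
    (fun x => μ x - π x)
  have h2 := Finset.sum_filter_add_sum_filter_not Finset.univ (fun x => μ x < π x)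
    (fun x => |μ x - π x|)
  have h3 : ∑ x with μ x < π x, |μ x - π x| = tvDist μ π :=
    Finset.sum_congr rfl fun x hx => by
      rw [abs_of_neg (sub_neg.2 (Finset.mem_filter.1 hx).2)]; ring
  have h4 : ∑ x with ¬ μ x < π x, |μ x - π x| = ∑ x with ¬ μ x < π x, (μ x - π x) :=
    Finset.sum_congr rfl fun x hx =>
      abs_of_nonneg (sub_nonneg.2 (not_lt.1 (Finset.mem_filter.1 hx).2))
  have h5 : ∑ x with μ x < π x, (μ x - π x) = - tvDist μ π := by
    rw [tvDist, ← Finset.sum_neg_distrib]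
    exact Finset.sum_congr rfl fun x _ => by ring
  linarith

/-- Total variation distance bounds differences of expectations. -/
lemma sum_mul_sub_sum_mul_le_tvDist {μ π F : X → ℝ} (h : ∑ x, μ x = ∑ x, π x)
    (hF : ∀ x, |F x| ≤ 1) : ∑ x, μ x * F x - ∑ x, π x * F x ≤ 2 * tvDist μ π := by
  rw [← sum_abs_sub_eq_two_mul_tvDist h, ← Finset.sum_sub_distrib]
  refine Finset.sum_le_sum fun x _ => ?_
  calc μ x * F x - π x * F x = (μ x - π x) * F x := by ring
    _ ≤ |(μ x - π x) * F x| := le_abs_self _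
    _ = |μ x - π x| * |F x| := abs_mul _ _
    _ ≤ |μ x - π x| := mul_le_of_le_one_right (abs_nonneg _) (hF x)

/-- Young's inequality for the conjugate pair a log a - a and exp; it is 1 + u ≤ exp u at u = x -
log a. -/
lemma mul_le_mul_log_sub_add_exp {a : ℝ} (ha : 0 ≤ a) (x : ℝ) :
    a * x ≤ a * Real.log a - a + Real.exp x := by
  rcases ha.eq_or_lt with rfl | ha
  · simp [Real.exp_nonneg]
  · have h := Real.add_one_le_exp (x - Real.log a)
    rw [Real.exp_sub, Real.exp_log ha, le_div_iff₀ ha] at h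
    linarith

/-- The Donsker–Varadhan lower bound for relative entropy. -/
lemma sum_mul_le_relEntropy_add_log [Nonempty X] {μ π : X → ℝ} (F : X → ℝ)
    (hμ : ∀ x, 0 ≤ μ x) (hπ : ∀ x, 0 < π x) (hμ1 : ∑ x, μ x = 1) :
    ∑ x, μ x * F x ≤ relEntropy μ π + Real.log (∑ x, π x * Real.exp (F x)) := by
  set Z := ∑ x, π x * Real.exp (F x) with hZ
  have hZ0 : 0 < Z := Finset.sum_pos (fun x _ => mul_pos (hπ x) (Real.exp_pos _))
    Finset.univ_nonempty
  -- Young's inequality with a = μ/π at F - log Z, weighted by π. After summation the last two terms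
  -- contribute -1 + 1 = 0.
  have key : ∀ x, μ x * F x - μ x * Real.log Z ≤
      μ x * Real.log (μ x / π x) - μ x + Z⁻¹ * (π x * Real.exp (F x)) := by
    intro x
    have h := mul_le_mul_of_nonneg_left
      (mul_le_mul_log_sub_add_exp (div_nonneg (hμ x) (hπ x).le) (F x - Real.log Z)) (hπ x).le
    have hx := (hπ x).ne'
    rw [Real.exp_sub, Real.exp_log hZ0] at h
    calc μ x * F x - μ x * Real.log Z = π x * (μ x / π x * (F x - Real.log Z)) := by
          field_simp
      _ ≤ _ := h
      _ = _ := by field_simp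
  have h := Finset.sum_le_sum fun x (_ : x ∈ Finset.univ) => key x
  rw [Finset.sum_sub_distrib, Finset.sum_add_distrib, Finset.sum_sub_distrib,
    ← Finset.sum_mul, ← Finset.mul_sum, hμ1, ← hZ, inv_mul_cancel₀ hZ0.ne'] at h
  unfold relEntropy
  linarith

/-- Cauchy–Schwarz lower bound for the `L²` distance. -/
lemma sq_sum_mul_sub_le_l2Dist_sq {μ π : X → ℝ} (F : X → ℝ) (hπ : ∀ x, 0 < π x) :
    (∑ x, μ x * F x - ∑ x, π x * F x) ^ 2 ≤ l2Dist μ π ^ 2 * ∑ x, π x * F x ^ 2 := by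
  rw [l2Dist, Real.sq_sqrt (Finset.sum_nonneg fun x _ => mul_nonneg (sq_nonneg _) (hπ x).le)]
  have h := Finset.sum_mul_sq_le_sq_mul_sq Finset.univ
    (fun x => (μ x / π x - 1) * √(π x)) (fun x => F x * √(π x))
  have e1 : ∑ x, (μ x / π x - 1) * √(π x) * (F x * √(π x))
      = ∑ x, μ x * F x - ∑ x, π x * F x := by
    rw [← Finset.sum_sub_distrib]
    refine Finset.sum_congr rfl fun x _ => ?_
    have hx := (hπ x).ne'
    calc _ = (μ x / π x - 1) * F x * (√(π x) * √(π x)) := by ring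
      _ = _ := by rw [Real.mul_self_sqrt (hπ x).le]; field_simp
  rw [e1] at h
  refine h.trans_eq ?_
  simp only [mul_pow, Real.sq_sqrt (hπ _).le]
  simp only [mul_comm]

lemma tvDist_le_of_le {μ π : X → ℝ} {p : ℝ} (hp : 0 ≤ p) (hπ : ∀ x, 0 ≤ π x)
    (hπ1 : ∑ x, π x = 1) (h : ∀ x, (1 - p) * π x ≤ μ x) : tvDist μ π ≤ p := by
  calc tvDist μ π ≤ ∑ x with μ x < π x, p * π x :=
        Finset.sum_le_sum fun x _ => by linarith [h x]
    _ ≤ ∑ x, p * π x := Finset.sum_le_sum_of_subset_of_nonneg (Finset.filter_subset _ _)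
        fun x _ _ => mul_nonneg hp (hπ x)
    _ = p := by rw [← Finset.mul_sum, hπ1, mul_one]

/-- Write μ as (1 - p) times uniform plus p times a probability measure of density v. By convexity
of x log x the uniform part contributes nothing, and v ≤ |X| bounds the rest by p log |X|. -/
lemma relEntropy_uniform_le [Nonempty X] {μ : X → ℝ} {p : ℝ} (hp : 0 < p) (hp1 : p ≤ 1)
    (hμ1 : ∑ x, μ x = 1) (h : ∀ x, (1 - p) * uniform X x ≤ μ x) :
    relEntropy μ (uniform X) ≤ p * Real.log (Fintype.card X) := by
  set K : ℝ := (Fintype.card X : ℝ) with hK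
  have hK0 : 0 < K := by simp [hK, Fintype.card_pos]
  have hu : ∀ x, uniform X x = K⁻¹ := fun x => by simp [uniform, hK]
  set v : X → ℝ := fun x => (μ x * K - (1 - p)) / p with hv
  have hv0 : ∀ x, 0 ≤ v x := fun x => by
    have := h x
    rw [hu, ← div_eq_mul_inv, div_le_iff₀ hK0] at this
    exact div_nonneg (by linarith) hp.le
  have hvs : ∑ x, v x = K := by
    have : ∑ x, v x = (K - K * (1 - p)) / p := by
      simp only [hv]
      rw [← Finset.sum_div, Finset.sum_sub_distrib, ← Finset.sum_mul, hμ1]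
      simp only [one_mul, Finset.sum_const, Finset.card_univ, nsmul_eq_mul, hK]
    rw [this]
    field_simp
    ring
  have hvK : ∀ x, v x ≤ K := fun x => hvs ▸
    Finset.single_le_sum (f := v) (fun x _ => hv0 x) (Finset.mem_univ x)
  have key : ∀ x, μ x * Real.log (μ x / uniform X x) ≤ K⁻¹ * (p * (v x * Real.log K)) := by
    intro x
    have hc := Real.convexOn_mul_log.2 (x := 1) (y := v x) (by simp) (by simpa using hv0 x)
      (sub_nonneg.2 hp1) hp.le (by ring)
    have e : (1 - p) • (1 : ℝ) + p • v x = μ x * K := by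
      simp only [hv, smul_eq_mul]; field_simp; ring
    simp only [e] at hc
    simp only [smul_eq_mul, Real.log_one, mul_zero, zero_add] at hc
    have hl : v x * Real.log (v x) ≤ v x * Real.log K := by
      rcases (hv0 x).eq_or_lt with h0 | h0
      · simp [← h0]
      · exact mul_le_mul_of_nonneg_left (Real.log_le_log h0 (hvK x)) h0.le
    rw [hu, div_inv_eq_mul]
    calc μ x * Real.log (μ x * K) = K⁻¹ * (μ x * K * Real.log (μ x * K)) := by field_simp
      _ ≤ _ := mul_le_mul_of_nonneg_left
        (hc.trans (mul_le_mul_of_nonneg_left hl hp.le)) (by positivity)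
  refine (Finset.sum_le_sum fun x _ => key x).trans_eq ?_
  rw [← Finset.mul_sum, ← Finset.mul_sum, ← Finset.sum_mul, hvs]
  field_simp

/-- A crude bound through total variation. It serves only to show that the L² distance eventually
falls below ε, so that the infimum defining `tauTwo` is attained. -/
lemma l2Dist_uniform_le [Nonempty X] {μ : X → ℝ} {p : ℝ} (hp : 0 ≤ p)
    (hμ1 : ∑ x, μ x = 1) (h : ∀ x, (1 - p) * uniform X x ≤ μ x) :
    l2Dist μ (uniform X) ≤ Fintype.card X * (2 * p) := by
  set K : ℝ := (Fintype.card X : ℝ) with hK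
  have hK0 : 0 < K := by simp [hK, Fintype.card_pos]
  have hu : ∀ x, uniform X x = K⁻¹ := fun x => by simp [uniform, hK]
  have htv := tvDist_le_of_le hp (fun x => (uniform_pos x).le) sum_uniform h
  have hd : ∀ x, |μ x - uniform X x| ≤ 2 * p := fun x =>
    ((Finset.single_le_sum (f := fun x => |μ x - uniform X x|) (fun x _ => abs_nonneg _)
      (Finset.mem_univ x)).trans_eq
      (sum_abs_sub_eq_two_mul_tvDist (hμ1.trans sum_uniform.symm))).trans (by linarith)
  refine Real.sqrt_le_iff.2 ⟨by positivity, ?_⟩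
  calc ∑ x, (μ x / uniform X x - 1) ^ 2 * uniform X x
      ≤ ∑ x, (K * (2 * p)) ^ 2 * uniform X x := by
        refine Finset.sum_le_sum fun x _ => mul_le_mul_of_nonneg_right ?_ (uniform_pos x).le
        refine sq_le_sq' ?_ ?_ <;> have hx := abs_le.1 (hd x) <;> rw [hu] at hx ⊢ <;>
          rw [div_inv_eq_mul]
        · have := mul_le_mul_of_nonneg_left hx.1 hK0.le
          rw [mul_sub, mul_inv_cancel₀ hK0.ne'] at this
          linarith
        · have := mul_le_mul_of_nonneg_left hx.2 hK0.le
          rw [mul_sub, mul_inv_cancel₀ hK0.ne'] at this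
          linarith
    _ = _ := by rw [← Finset.mul_sum, sum_uniform, mul_one]

end Discrepancy

/-! ### Doeblin iteration, and the infimum in the mixing time. -/

section Doeblin

variable {X : Type*} [Fintype X] [DecidableEq X]

lemma pow_mem_rowStochastic {P : Matrix X X ℝ} (hP : P ∈ rowStochastic ℝ X) (t : ℕ) :
    P ^ t ∈ rowStochastic ℝ X := pow_mem hP t

lemma sum_col_of_symm {Q : Matrix X X ℝ} (hQ : Q ∈ rowStochastic ℝ X) (hs : Qᵀ = Q) (y : X) :
    ∑ z, Q z y = 1 := by
  rw [← sum_row_of_mem_rowStochastic hQ y]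
  exact Finset.sum_congr rfl fun z _ => by rw [← transpose_apply Q, hs]

/-- Split Q into δ times the uniform kernel and a nonnegative remainder of row mass 1 - δ. Symmetry
makes columns sum to 1, so the uniform part stays uniform under further steps; the induction
hypothesis handles the remainder. -/
lemma le_pow_apply_of_minorization {Q : Matrix X X ℝ} (hQ : Q ∈ rowStochastic ℝ X)
    (hs : Qᵀ = Q) {δ : ℝ} (h : ∀ x y, δ * uniform X y ≤ Q x y) (k : ℕ) :
    ∀ x y, (1 - (1 - δ) ^ k) * uniform X y ≤ (Q ^ k) x y := by
  induction k with
  | zero => intro x y; simpa using (pow_mem_rowStochastic hQ 0).1 x y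
  | succ k ih =>
    intro x y
    have : Nonempty X := ⟨x⟩
    have hk : (Q ^ k)ᵀ = Q ^ k := by rw [transpose_pow, hs]
    have h1 : ∑ z, (Q x z - δ * uniform X z) * ((1 - (1 - δ) ^ k) * uniform X y) ≤
        ∑ z, (Q x z - δ * uniform X z) * (Q ^ k) z y :=
      Finset.sum_le_sum fun z _ => mul_le_mul_of_nonneg_left (ih z y) (sub_nonneg.2 (h x z))
    have h2 : ∑ z, δ * uniform X z * (Q ^ k) z y = δ * uniform X y := by
      have : ∀ z, uniform X z = uniform X y := fun _ => rfl
      simp only [this, ← Finset.mul_sum]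
      rw [sum_col_of_symm (pow_mem_rowStochastic hQ k) hk, mul_one]
    rw [← Finset.sum_mul, Finset.sum_sub_distrib, ← Finset.mul_sum, sum_uniform,
      sum_row_of_mem_rowStochastic hQ] at h1
    simp only [sub_mul, Finset.sum_sub_distrib, h2] at h1
    rw [pow_succ' Q, mul_apply, pow_succ]
    linarith

/-- A symmetric chain whose `T`-step transitions dominate `δ` times the uniform distribution
approaches the uniform distribution at a geometric rate. -/
lemma le_pow_apply_of_minorization_pow {P : Matrix X X ℝ} (hP : P ∈ rowStochastic ℝ X)
    (hs : Pᵀ = P) {δ : ℝ} {T : ℕ}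
    (h : ∀ x y, δ * uniform X y ≤ (P ^ T) x y) (s : ℕ) (x y : X) :
    (1 - (1 - δ) ^ (s / T)) * uniform X y ≤ (P ^ s) x y := by
  have h1 := le_pow_apply_of_minorization (pow_mem_rowStochastic hP T)
    (by rw [transpose_pow, hs]) h (s / T)
  have h2 := pow_mem_rowStochastic hP (s % T)
  have h3 : P ^ s = P ^ (s % T) * (P ^ T) ^ (s / T) := by
    rw [← pow_mul, ← pow_add, Nat.mod_add_div]
  rw [h3, mul_apply]
  calc _ = ∑ z, (P ^ (s % T)) x z * ((1 - (1 - δ) ^ (s / T)) * uniform X y) := by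
        rw [← Finset.sum_mul, sum_row_of_mem_rowStochastic h2, one_mul]
    _ ≤ _ := Finset.sum_le_sum fun z _ => mul_le_mul_of_nonneg_left (h1 z y) (h2.1 x z)

lemma mixingTime_le {d : (X → ℝ) → (X → ℝ) → ℝ} {P : Matrix X X ℝ} {π : X → ℝ} {ε : ℝ} {t : ℕ}
    (h : ∀ s, t ≤ s → ∀ x, d ((P ^ s) x) π ≤ ε) : mixingTime d P π ε ≤ t :=
  Nat.sInf_le h

/-- Some valid `t` must be supplied: the infimum of the empty set in ℕ is 0, at which the distance
need not be small. -/
lemma le_of_mixingTime {d : (X → ℝ) → (X → ℝ) → ℝ} {P : Matrix X X ℝ} {π : X → ℝ} {ε : ℝ}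
    {t : ℕ} (h : ∀ s, t ≤ s → ∀ x, d ((P ^ s) x) π ≤ ε) (x : X) :
    d ((P ^ mixingTime d P π ε) x) π ≤ ε :=
  Nat.sInf_mem (s := {t : ℕ | ∀ s : ℕ, t ≤ s → ∀ x : X, d ((P ^ s) x) π ≤ ε}) ⟨t, h⟩ _ le_rfl x

end Doeblin

/-! ### Fourier analysis of the walk on the cycle. -/

section CycleWalk

variable {n : ℕ} [NeZero n] {β : ℝ}

lemma cycleWalk_mulVec (f : ZMod n → ℝ) (x : ZMod n) :
    (cycleWalk n β *ᵥ f) x =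
      β * f x + (1 - β) / 2 * f (x + 1) + (1 - β) / 2 * f (x - 1) := by
  simp [mulVec, dotProduct, cycleWalk, add_mul, Finset.sum_add_distrib]

lemma cycleWalk_transpose {n : ℕ} : (cycleWalk n β)ᵀ = cycleWalk n β := by
  ext x y
  have h1 : (x = y + 1) = (y = x - 1) := by rw [eq_iff_iff, eq_sub_iff_add_eq, eq_comm]
  have h2 : (x = y - 1) = (y = x + 1) := by rw [eq_iff_iff, eq_sub_iff_add_eq, eq_comm]
  simp only [transpose_apply, cycleWalk, h1, h2, eq_comm (a := x) (b := y)]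
  ring

lemma cycleWalk_mem_rowStochastic (hβ0 : 0 ≤ β) (hβ1 : β < 1) :
    cycleWalk n β ∈ rowStochastic ℝ (ZMod n) := by
  have : 0 ≤ (1 - β) / 2 := by linarith
  refine ⟨fun x y => ?_, ?_⟩
  · unfold cycleWalk
    refine add_nonneg (add_nonneg ?_ ?_) ?_ <;> split_ifs <;> first | assumption | exact le_rfl
  · funext x
    rw [cycleWalk_mulVec]
    simp only [Pi.one_apply]
    ring

/-- The function `a ↦ cos (2πa / n)` on the cycle. -/
def cycleCos (a : ZMod n) : ℝ := (ZMod.stdAddChar a : ℂ).re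

lemma cycleCos_natCast (j : ℕ) : cycleCos (j : ZMod n) = Real.cos (2 * Real.pi * j / n) := by
  have h := ZMod.stdAddChar_coe (N := n) (j : ℤ)
  rw [cycleCos]
  push_cast at h
  rw [h, show (2 * Real.pi * Complex.I * j / n : ℂ) = ((2 * Real.pi * j / n : ℝ) : ℂ) * Complex.I by
    push_cast; ring, Complex.exp_ofReal_mul_I_re]

lemma cycleCos_zero : cycleCos (0 : ZMod n) = 1 := by simp [cycleCos]

lemma cycleCos_eq_cos_val (a : ZMod n) :
    cycleCos a = Real.cos (2 * Real.pi * a.val / n) := by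
  rw [← cycleCos_natCast, ZMod.natCast_zmod_val]

lemma abs_cycleCos_le_one (a : ZMod n) : |cycleCos a| ≤ 1 := by
  rw [cycleCos_eq_cos_val]; exact Real.abs_cos_le_one _

lemma cycleCos_add_add_cycleCos_sub (a b : ZMod n) :
    cycleCos (a + b) + cycleCos (a - b) = 2 * cycleCos a * cycleCos b := by
  have h1 : cycleCos (a + b) = Real.cos (2 * Real.pi * a.val / n + 2 * Real.pi * b.val / n) := by
    conv_lhs => rw [← ZMod.natCast_zmod_val a, ← ZMod.natCast_zmod_val b, ← Nat.cast_add,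
      cycleCos_natCast]
    congr 1; push_cast; ring
  have h2 : cycleCos (a - b) = Real.cos (2 * Real.pi * a.val / n - 2 * Real.pi * b.val / n) := by
    have hn : (n : ℝ) ≠ 0 := Nat.cast_ne_zero.2 (NeZero.ne n)
    have hb : b.val ≤ n := (ZMod.val_lt b).le
    have : a - b = ((a.val + (n - b.val) : ℕ) : ZMod n) := by
      push_cast [Nat.cast_sub hb]
      simp [sub_eq_add_neg]
    rw [this, cycleCos_natCast, ← Real.cos_add_two_pi (_ - _)]
    congr 1; push_cast [Nat.cast_sub hb]; field_simp; ring
  rw [h1, h2, Real.cos_add, Real.cos_sub, cycleCos_eq_cos_val, cycleCos_eq_cos_val]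
  ring

lemma cycleCos_two_mul (a : ZMod n) : cycleCos (2 * a) = 2 * cycleCos a ^ 2 - 1 := by
  have := cycleCos_add_add_cycleCos_sub a a
  rw [sub_self, cycleCos_zero, ← two_mul] at this
  linarith

lemma sum_cycleCos_mul (d : ZMod n) :
    ∑ a : ZMod n, cycleCos (a * d) = if d = 0 then (n : ℝ) else 0 := by
  have h := AddChar.sum_mulShift d (ZMod.isPrimitive_stdAddChar n)
  have h2 := congrArg Complex.re h
  rw [Complex.re_sum] at h2
  refine Eq.trans h2 ?_
  split_ifs <;> simp

/-- The eigenvalues of the walk on the cycle. -/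
def cycleEigenvalue (β : ℝ) (a : ZMod n) : ℝ := β + (1 - β) * cycleCos a

lemma cycleWalk_mulVec_cycleCos (a y : ZMod n) :
    cycleWalk n β *ᵥ (fun x => cycleCos (a * (x - y))) =
      fun x => cycleEigenvalue β a * cycleCos (a * (x - y)) := by
  funext x
  rw [cycleWalk_mulVec, cycleEigenvalue,
    show a * (x + 1 - y) = a * (x - y) + a by ring,
    show a * (x - 1 - y) = a * (x - y) - a by ring]
  linear_combination (1 - β) / 2 * cycleCos_add_add_cycleCos_sub (a * (x - y)) a

/-- At time 0 this is orthogonality of characters; afterwards each cosine is an eigenfunction in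
`x`. -/
lemma cycleWalk_pow_apply (t : ℕ) (y : ZMod n) : ∀ x,
    (cycleWalk n β ^ t) x y =
      (n : ℝ)⁻¹ * ∑ a : ZMod n, cycleEigenvalue β a ^ t * cycleCos (a * (x - y)) := by
  have hn : (n : ℝ) ≠ 0 := Nat.cast_ne_zero.2 (NeZero.ne n)
  induction t with
  | zero =>
    intro x
    simp only [pow_zero, one_mul, sum_cycleCos_mul, one_apply, sub_eq_zero]
    split_ifs <;> simp [hn]
  | succ t ih =>
    intro x
    have h1 : (cycleWalk n β ^ (t + 1)) x y =
        (cycleWalk n β *ᵥ fun z => (cycleWalk n β ^ t) z y) x := by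
      rw [pow_succ']; rfl
    rw [h1]
    simp only [ih, mulVec, dotProduct, Finset.mul_sum]
    rw [Finset.sum_comm]
    refine Finset.sum_congr rfl fun a _ => ?_
    have h2 := congrFun (cycleWalk_mulVec_cycleCos (β := β) a y) x
    simp only [mulVec, dotProduct] at h2
    calc _ = (n : ℝ)⁻¹ * cycleEigenvalue β a ^ t *
          ∑ z, cycleWalk n β x z * cycleCos (a * (z - y)) := by
          rw [Finset.mul_sum]; exact Finset.sum_congr rfl fun _ _ => by ring
      _ = _ := by rw [h2]; ring

lemma one_sub_cos_ge {n j : ℕ} (hn : 0 < n) (hj : 2 * j ≤ n) :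
    8 * (j : ℝ) ^ 2 / n ^ 2 ≤ 1 - Real.cos (2 * Real.pi * j / n) := by
  have hn' : (0 : ℝ) < n := Nat.cast_pos.2 hn
  have hj' : (2 : ℝ) * j ≤ n := by exact_mod_cast hj
  have hπ := Real.pi_pos
  have h := Real.cos_le_one_sub_mul_cos_sq (x := 2 * Real.pi * j / n) (by
    rw [abs_of_nonneg (by positivity), div_le_iff₀ hn']
    nlinarith)
  have e : 2 / Real.pi ^ 2 * (2 * Real.pi * j / n) ^ 2 = 8 * (j : ℝ) ^ 2 / n ^ 2 := by
    field_simp; ring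
  linarith

/-- If j is the distance from `a` to 0 on the cycle, then 1 - cos ≥ 8j²/n² ≥ 8j/n². Here j is
`a.val` or `n - a.val`, and adding both powers avoids a case distinction when summing over `a`. -/
lemma exp_neg_one_sub_cycleCos_le {b : ℝ} (hb : 0 ≤ b) (a : ZMod n) (ha : a ≠ 0) :
    Real.exp (-(b * (1 - cycleCos a))) ≤
      Real.exp (-(8 * b / n ^ 2)) ^ a.val + Real.exp (-(8 * b / n ^ 2)) ^ (n - a.val) := by
  have hn : 0 < n := NeZero.pos n
  have main : ∀ j : ℕ, 1 ≤ j → 2 * j ≤ n → cycleCos a = Real.cos (2 * Real.pi * j / n) →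
      Real.exp (-(b * (1 - cycleCos a))) ≤ Real.exp (-(8 * b / n ^ 2)) ^ j := by
    intro j hj1 hj hc
    rw [← Real.exp_nat_mul, Real.exp_le_exp, hc]
    have h1 := mul_le_mul_of_nonneg_left (one_sub_cos_ge hn hj) hb
    have h2 : (j : ℝ) ≤ (j : ℝ) ^ 2 := by
      have : (1 : ℝ) ≤ j := by exact_mod_cast hj1
      nlinarith
    have h3 : (8 * b / n ^ 2) * j ≤ (8 * b / n ^ 2) * (j : ℝ) ^ 2 :=
      mul_le_mul_of_nonneg_left h2 (by positivity)
    have h4 : b * (8 * (j : ℝ) ^ 2 / n ^ 2) = (8 * b / n ^ 2) * (j : ℝ) ^ 2 := by ring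
    linarith
  have hlt := ZMod.val_lt a
  have hpos : 0 < a.val := ZMod.val_pos.2 ha
  by_cases h : 2 * a.val ≤ n
  · exact (main _ hpos h (cycleCos_eq_cos_val a)).trans (le_add_of_nonneg_right (by positivity))
  · refine (main (n - a.val) (by omega) (by omega) ?_).trans
      (le_add_of_nonneg_left (by positivity))
    rw [cycleCos_eq_cos_val, ← Real.cos_two_pi_sub]
    congr 1
    push_cast [Nat.cast_sub hlt.le]
    have hn' : (n : ℝ) ≠ 0 := Nat.cast_ne_zero.2 hn.ne'
    field_simp

lemma sum_exp_neg_one_sub_cycleCos_le {b : ℝ} (hb : Real.log 5 / 8 * n ^ 2 ≤ b) :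
    ∑ a : ZMod n with a ≠ 0, Real.exp (-(b * (1 - cycleCos a))) ≤ 1 / 2 := by
  have hn : 0 < n := NeZero.pos n
  have hn' : (0 : ℝ) < n := Nat.cast_pos.2 hn
  have hl : 0 < Real.log 5 := Real.log_pos (by norm_num)
  have hb0 : 0 ≤ b := le_trans (by positivity) hb
  set r := Real.exp (-(8 * b / n ^ 2)) with hr
  have hr0 : 0 < r := Real.exp_pos _
  -- The threshold log 5 / 8 makes the ratio at most 1/5, so each of the two geometric series is at
  -- most 1/4.
  have hr5 : r ≤ 1 / 5 := by
    rw [hr, one_div, ← Real.exp_log (show (0 : ℝ) < 5 by norm_num), ← Real.exp_neg,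
      Real.exp_le_exp, neg_le_neg_iff, le_div_iff₀ (by positivity)]
    linarith
  have h1 : ∑ a : ZMod n with a ≠ 0, Real.exp (-(b * (1 - cycleCos a))) ≤
      ∑ a : ZMod n with a ≠ 0, (r ^ a.val + r ^ (n - a.val)) :=
    Finset.sum_le_sum fun a ha =>
      exp_neg_one_sub_cycleCos_le hb0 a (Finset.mem_filter.1 ha).2
  have h2 : ∑ a : ZMod n with a ≠ 0, (r ^ a.val + r ^ (n - a.val)) =
      ∑ j ∈ Finset.Ico 1 n, (r ^ j + r ^ (n - j)) := by
    refine Finset.sum_nbij' ZMod.val (fun j => (j : ZMod n)) ?_ ?_ (by simp) ?_ (by simp)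
    · intro a ha
      simp only [Finset.mem_filter, Finset.mem_univ, true_and] at ha
      exact Finset.mem_Ico.2 ⟨ZMod.val_pos.2 ha, ZMod.val_lt a⟩
    · intro j hj
      rw [Finset.mem_Ico] at hj
      simp only [Finset.mem_filter, Finset.mem_univ, true_and, ne_eq]
      rw [← ZMod.val_eq_zero, ZMod.val_cast_of_lt hj.2]
      omega
    · intro j hj
      exact ZMod.val_cast_of_lt (Finset.mem_Ico.1 hj).2
  have h3 : ∑ j ∈ Finset.Ico 1 n, r ^ (n - j) = ∑ j ∈ Finset.Ico 1 n, r ^ j := by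
    refine Finset.sum_nbij' (fun j => n - j) (fun j => n - j) ?_ ?_ ?_ ?_ ?_ <;>
      intro j hj <;> rw [Finset.mem_Ico] at hj <;> try simp only [Finset.mem_Ico]
    all_goals first | rfl | omega
  have h4 := geom_sum_Ico_le_of_lt_one (m := 1) (n := n) hr0.le (by linarith)
  rw [h2, Finset.sum_add_distrib, h3] at h1
  have h5 : r ^ 1 / (1 - r) ≤ 1 / 4 := by
    rw [pow_one, div_le_iff₀ (by linarith)]; linarith
  linarith

/-- The spectral gap constant of the squared walk. -/
def gapConst (β : ℝ) : ℝ := if β = 0 then 1 / 2 else 2 * β * (1 - β)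

lemma gapConst_pos (hβ0 : 0 ≤ β) (hβ1 : β < 1) : 0 < gapConst β := by
  unfold gapConst
  split_ifs with h
  · norm_num
  · have : 0 < β := lt_of_le_of_ne hβ0 (Ne.symm h)
    have : 0 < 1 - β := by linarith
    positivity

/-- Squaring controls eigenvalues near -1. For β = 0, cos² θ = 1 - (1 - cos 2θ)/2, and doubling
permutes the nonzero residues as n is odd. For β > 0, the bound 1 - 2β(1 - β)(1 - c) exceeds the
squared eigenvalue by (1 - β)²(1 - c)(1 + c), with c the cosine. -/
lemma sum_cycleEigenvalue_sq_pow_le (hβ1 : β < 1) (hodd : β = 0 → Odd n) {s : ℕ}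
    (hs : Real.log 5 / 8 * n ^ 2 ≤ gapConst β * s) :
    ∑ a : ZMod n with a ≠ 0, (cycleEigenvalue β a ^ 2) ^ s ≤ 1 / 2 := by
  refine le_trans ?_ (sum_exp_neg_one_sub_cycleCos_le hs)
  have key : ∀ x y : ℝ, 0 ≤ x → x ≤ 1 - gapConst β * (1 - y) →
      x ^ s ≤ Real.exp (-(gapConst β * s * (1 - y))) := by
    intro x y hx h
    have h1 : x ≤ Real.exp (-(gapConst β * (1 - y))) :=
      h.trans (by linarith [Real.add_one_le_exp (-(gapConst β * (1 - y)))])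
    refine (pow_le_pow_left₀ hx h1 s).trans_eq ?_
    rw [← Real.exp_nat_mul]
    congr 1; ring
  by_cases h0 : β = 0
  · have hu : IsUnit (2 : ZMod n) := by
      have := (ZMod.isUnit_iff_coprime 2 n).2 ((Nat.coprime_two_left).2 (hodd h0))
      exact_mod_cast this
    obtain ⟨u, hu⟩ := hu
    refine le_trans (Finset.sum_le_sum (g := fun a : ZMod n =>
      Real.exp (-(gapConst β * s * (1 - cycleCos (2 * a))))) fun a _ =>
        key _ _ (sq_nonneg _) ?_) (le_of_eq ?_)
    · simp only [gapConst, if_pos h0, cycleCos_two_mul, cycleEigenvalue]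
      rw [h0]
      apply le_of_eq; ring
    · refine Finset.sum_nbij' (fun a => u * a) (fun a => (↑u⁻¹ : ZMod n) * a) ?_ ?_ ?_ ?_ ?_ <;>
        simp
      exact fun a _ => Or.inl (by rw [hu])
  · refine Finset.sum_le_sum fun a _ => key _ _ (sq_nonneg _) ?_
    simp only [gapConst, if_neg h0, cycleEigenvalue]
    have hc := abs_le.1 (abs_cycleCos_le_one a)
    have : 0 ≤ (1 - β) ^ 2 * ((1 - cycleCos a) * (1 + cycleCos a)) := by
      have h1 : 0 ≤ 1 - cycleCos a := by linarith
      have h2 : 0 ≤ 1 + cycleCos a := by linarith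
      positivity
    nlinarith

/-- After order `n²` steps the position is within a factor two of uniform from below. -/
lemma cycleWalk_pow_apply_ge (hβ1 : β < 1) (hodd : β = 0 → Odd n) {s : ℕ}
    (hs : Real.log 5 / 8 * n ^ 2 ≤ gapConst β * s) (x y : ZMod n) :
    (n : ℝ)⁻¹ / 2 ≤ (cycleWalk n β ^ (2 * s)) x y := by
  rw [cycleWalk_pow_apply, div_eq_mul_inv]
  refine mul_le_mul_of_nonneg_left ?_ (by positivity)
  have h := sum_cycleEigenvalue_sq_pow_le hβ1 hodd hs
  rw [← Finset.sum_filter_add_sum_filter_not Finset.univ (fun a : ZMod n => a ≠ 0)]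
  -- The constant mode contributes 1; the others together contribute at least -1/2.
  have h1 : ∑ a : ZMod n with ¬ a ≠ 0, cycleEigenvalue β a ^ (2 * s) * cycleCos (a * (x - y))
      = 1 := by
    simp [cycleEigenvalue, cycleCos_zero, Finset.filter_eq']
  have h2 : -∑ a : ZMod n with a ≠ 0, (cycleEigenvalue β a ^ 2) ^ s ≤
      ∑ a : ZMod n with a ≠ 0, cycleEigenvalue β a ^ (2 * s) * cycleCos (a * (x - y)) := by
    rw [← Finset.sum_neg_distrib]
    refine Finset.sum_le_sum fun a _ => ?_
    rw [pow_mul]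
    have h3 : 0 ≤ (cycleEigenvalue β a ^ 2) ^ s := by positivity
    have h4 := (abs_le.1 (abs_cycleCos_le_one (a * (x - y)))).1
    nlinarith
  linarith

end CycleWalk

/-! ### Covering the cycle and the Doeblin minorization. -/

section Cover

variable {n m : ℕ} [NeZero n] [NeZero m] {β : ℝ}

/-- The value at `k` of the Dirichlet eigenfunction used to bound the exit time of `(-n, n)`. -/
def exitFun (n : ℕ) (k : ℤ) : ℝ := Real.cos (Real.pi * k / (3 * n))

/-- The eigenvalue of `exitFun`. -/
def exitRate (β : ℝ) (n : ℕ) : ℝ := β + (1 - β) * Real.cos (Real.pi / (3 * n))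

lemma exitFun_step {n : ℕ} (k : ℤ) : β * exitFun n k + (1 - β) / 2 * exitFun n (k + 1) +
    (1 - β) / 2 * exitFun n (k - 1) = exitRate β n * exitFun n k := by
  have h1 : Real.pi * ((k + 1 : ℤ) : ℝ) / (3 * n) =
      Real.pi * k / (3 * n) + Real.pi / (3 * n) := by push_cast; ring
  have h2 : Real.pi * ((k - 1 : ℤ) : ℝ) / (3 * n) =
      Real.pi * k / (3 * n) - Real.pi / (3 * n) := by push_cast; ring
  simp only [exitFun, exitRate, h1, h2, Real.cos_add, Real.cos_sub]
  ring

/-- The scale 3n keeps the angle within π/3, so twice the eigenfunction dominates 1 on all of [-n,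
n]. -/
lemma half_le_exitFun {k : ℤ} (hk : |k| ≤ n) : 1 / 2 ≤ exitFun n k := by
  have hn' : (0 : ℝ) < n := Nat.cast_pos.2 (NeZero.pos n)
  have hk' : |(k : ℝ)| ≤ n := by exact_mod_cast hk
  rw [exitFun, ← Real.cos_abs, ← Real.cos_pi_div_three]
  have e : |Real.pi * k / (3 * n)| = Real.pi * |(k : ℝ)| / (3 * n) := by
    rw [abs_div, abs_mul, abs_of_pos Real.pi_pos, abs_of_pos (show (0 : ℝ) < 3 * n by positivity)]
  rw [e]
  refine Real.cos_le_cos_of_nonneg_of_le_pi (by positivity) (by linarith [Real.pi_pos]) ?_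
  rw [div_le_div_iff₀ (by positivity) (by norm_num)]
  nlinarith [Real.pi_pos]

lemma exitRate_nonneg (hβ0 : 0 ≤ β) (hβ1 : β < 1) : 0 ≤ exitRate β n := by
  have h : 1 / 2 ≤ exitFun n 1 := half_le_exitFun (by
    have := NeZero.pos n
    rw [abs_one]; omega)
  have h1 : exitFun n 1 = Real.cos (Real.pi / (3 * n)) := by simp [exitFun]
  rw [h1] at h
  unfold exitRate
  nlinarith

/-- The constant 9/2 comes from cos (π/(3n)) ≤ 1 - 2/(9n²). -/
lemma exitRate_pow_le (hβ0 : 0 ≤ β) (hβ1 : β < 1) {t : ℕ}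
    (ht : 9 / 2 * Real.log 4 * n ^ 2 ≤ (1 - β) * t) : exitRate β n ^ t ≤ 1 / 4 := by
  have hn : (1 : ℝ) ≤ n := by exact_mod_cast NeZero.pos n
  have hn' : (0 : ℝ) < n := by linarith
  have hβ : 0 < 1 - β := by linarith
  have h1 : Real.cos (Real.pi / (3 * n)) ≤ 1 - 2 / (9 * n ^ 2) := by
    refine (Real.cos_le_one_sub_mul_cos_sq ?_).trans_eq ?_
    · rw [abs_of_nonneg (by positivity)]
      exact div_le_self Real.pi_pos.le (by linarith)
    · field_simp; ring
  have h2 : exitRate β n ≤ Real.exp (-((1 - β) * (2 / (9 * n ^ 2)))) := by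
    have := mul_le_mul_of_nonneg_left h1 hβ.le
    have := Real.add_one_le_exp (-((1 - β) * (2 / (9 * (n : ℝ) ^ 2))))
    unfold exitRate
    linarith
  refine (pow_le_pow_left₀ (exitRate_nonneg hβ0 hβ1) h2 t).trans ?_
  rw [← Real.exp_nat_mul, one_div, ← Real.exp_log (show (0 : ℝ) < 4⁻¹ by norm_num),
    Real.exp_le_exp, Real.log_inv]
  have e : (t : ℝ) * -((1 - β) * (2 / (9 * n ^ 2))) = -((1 - β) * t * 2 / (9 * n ^ 2)) := by ring
  rw [e, neg_le_neg_iff, le_div_iff₀ (by positivity)]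
  linarith

lemma le_avgOn_univ_pow (hβ0 : 0 ≤ β) (hβ1 : β < 1) {F : State (ZMod n) m → ℝ} {l : ℝ}
    (hl : ∀ z g, l ≤ avgOn Finset.univ (fun g => F (g, z)) g) (t : ℕ) (y : ZMod n)
    (g : ZMod n → Fin m) :
    l ≤ avgOn Finset.univ (fun g => ((cycleLamp n m β ^ t) *ᵥ F) (g, y)) g := by
  have hP := pow_mem_rowStochastic (cycleWalk_mem_rowStochastic (n := n) hβ0 hβ1) t
  rw [cycleLamp, avgOn_univ_pow]
  calc l = ∑ z, (cycleWalk n β ^ t) y z * l := by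
        rw [← Finset.sum_mul, sum_row_of_mem_rowStochastic hP, one_mul]
    _ ≤ _ := Finset.sum_le_sum fun z _ => mul_le_mul_of_nonneg_left (hl z g) (hP.1 y z)

/-- Lower bound for the evolution of a nonnegative function: up to an exponentially small
probability, the lifted walk has left `(-n, n)` and every lamp has been randomized. -/
lemma le_avgOn_pow (hβ0 : 0 ≤ β) (hβ1 : β < 1) {F : State (ZMod n) m → ℝ} (hF : ∀ s, 0 ≤ F s)
    {l : ℝ} (hl0 : 0 ≤ l) (hl : ∀ z g, l ≤ avgOn Finset.univ (fun g => F (g, z)) g)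
    (g : ZMod n → Fin m) (x : ZMod n) (t : ℕ) : ∀ (k : ℤ) (S : Finset (ZMod n)), |k| ≤ n →
    (∀ j : ℤ, (0 ≤ j ∧ j < k ∨ k < j ∧ j ≤ 0) → x + (j : ZMod n) ∈ S) →
    l * (1 - 2 * exitRate β n ^ t * exitFun n k) ≤
      avgOn S (fun g => ((cycleLamp n m β ^ t) *ᵥ F) (g, x + (k : ZMod n))) g := by
  have hρ := exitRate_nonneg (n := n) hβ0 hβ1
  have hfull : ∀ (t : ℕ) (k : ℤ) (S : Finset (ZMod n)), |k| ≤ n → ¬ |k| < n →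
      (∀ j : ℤ, (0 ≤ j ∧ j < k ∨ k < j ∧ j ≤ 0) → x + (j : ZMod n) ∈ S) →
      l * (1 - 2 * exitRate β n ^ t * exitFun n k) ≤
        avgOn S (fun g => ((cycleLamp n m β ^ t) *ᵥ F) (g, x + (k : ZMod n))) g := by
    intro t k S hk hk' hS
    -- Once k = ±n, the n integers from 0 up to but excluding k cover every residue class.
    have hU : S = Finset.univ := by
      refine Finset.eq_univ_iff_forall.2 fun v => ?_
      have hv := ZMod.val_lt (v - x)
      have hv' := ZMod.val_lt (x - v)
      rcases abs_cases k with ⟨h, _⟩ | ⟨h, _⟩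
      · have := hS ((v - x).val : ℤ) (by omega)
        simpa using this
      · have := hS (-(x - v).val : ℤ) (by omega)
        simpa using this
    rw [hU]
    refine le_trans ?_ (le_avgOn_univ_pow hβ0 hβ1 hl t _ g)
    have := half_le_exitFun hk
    have h0 : 0 ≤ exitRate β n ^ t := pow_nonneg hρ t
    refine mul_le_of_le_one_right hl0 ?_
    have : 0 ≤ exitRate β n ^ t * exitFun n k := mul_nonneg h0 (by linarith)
    linarith
  induction t with
  | zero =>
    intro k S hk hS
    by_cases hk' : |k| < n
    -- At time 0 the left side is nonpositive, because `exitFun` is at least 1/2.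
    · refine le_trans ?_ (avgOn_nonneg (fun g => ?_) g)
      · have := half_le_exitFun hk
        refine mul_nonpos_of_nonneg_of_nonpos hl0 ?_
        simp only [pow_zero]
        linarith
      · simpa using hF _
    · exact hfull 0 k S hk hk' hS
  | succ t ih =>
    intro k S hk hS
    by_cases hk' : |k| < n
    · set G : ZMod n → ℝ := fun z => avgOn (insert z (insert (x + (k : ZMod n)) S))
        (fun g => ((cycleLamp n m β ^ t) *ᵥ F) (g, z)) g with hG
      have h1 : avgOn S (fun g => ((cycleLamp n m β ^ (t + 1)) *ᵥ F) (g, x + (k : ZMod n))) g =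
          (cycleWalk n β *ᵥ G) (x + (k : ZMod n)) := by
        simp only [pow_succ', ← mulVec_mulVec]
        exact avgOn_lamplighterChain _ _ _ _ _
      have h2 : ∀ k' : ℤ, |k'| ≤ n → (k' = k ∨ k' = k + 1 ∨ k' = k - 1) →
          l * (1 - 2 * exitRate β n ^ t * exitFun n k') ≤ G (x + (k' : ZMod n)) := by
        intro k' hk1 hk2
        -- Moving from k to a neighbour requires at most the extra index j = k, whose lamp this step
        -- has just randomized.
        refine ih k' _ hk1 fun j hj => ?_
        by_cases hjk : j = k
        · simp [hjk]
        · refine Finset.mem_insert_of_mem (Finset.mem_insert_of_mem (hS j ?_))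
          omega
      rw [abs_lt] at hk'
      have a1 := h2 k hk (Or.inl rfl)
      have a2 := h2 (k + 1) (abs_le.2 (by omega)) (by simp)
      have a3 := h2 (k - 1) (abs_le.2 (by omega)) (by simp)
      rw [h1, cycleWalk_mulVec, pow_succ]
      push_cast at a2 a3
      rw [← add_assoc] at a2
      rw [← add_sub_assoc] at a3
      have hβ' : 0 ≤ (1 - β) / 2 := by linarith
      have b1 := mul_le_mul_of_nonneg_left a1 hβ0
      have b2 := mul_le_mul_of_nonneg_left a2 hβ'
      have b3 := mul_le_mul_of_nonneg_left a3 hβ'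
      refine le_trans (le_of_eq ?_) (add_le_add (add_le_add b1 b2) b3)
      linear_combination (2 * l * exitRate β n ^ t) * exitFun_step (n := n) (β := β) k
    · exact hfull _ k S hk hk' hS

/-- The first `t` steps fail to randomize all lamps with probability at most 2 · 1/4; the next `2 *
s` steps spread the position to half the uniform mass. The two factors 1/2 give 1/4. -/
lemma cycleLamp_pow_apply_ge (hβ0 : 0 ≤ β) (hβ1 : β < 1) (hodd : β = 0 → Odd n) {t s : ℕ}
    (ht : 9 / 2 * Real.log 4 * n ^ 2 ≤ (1 - β) * t)
    (hs : Real.log 5 / 8 * n ^ 2 ≤ gapConst β * s) (u v : State (ZMod n) m) :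
    1 / 4 * uniform (State (ZMod n) m) v ≤ (cycleLamp n m β ^ (t + 2 * s)) u v := by
  obtain ⟨f, x⟩ := u
  obtain ⟨f', x'⟩ := v
  have hm : (m : ℝ) ≠ 0 := Nat.cast_ne_zero.2 (NeZero.ne m)
  set e : State (ZMod n) m → ℝ := Pi.single (f', x') 1 with he
  have hcol : ∀ (k : ℕ) (u : State (ZMod n) m),
      (cycleLamp n m β ^ k) u (f', x') = ((cycleLamp n m β ^ k) *ᵥ e) u := by
    intro k u; simp [he]
  have hav : ∀ (g : ZMod n → Fin m) (z : ZMod n), avgOn Finset.univ (fun g => e (g, z)) g =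
      ((m : ℝ) ^ n)⁻¹ * (if z = x' then 1 else 0) := by
    intro g z
    simp only [avgOn, Finset.piecewise_univ, ZMod.card]
    congr 1
    by_cases h : z = x'
    · subst h
      simp [he, Pi.single_apply, Prod.ext_iff]
    · simp [he, Prod.ext_iff, h]
  set l : ℝ := ((m : ℝ) ^ n)⁻¹ * ((n : ℝ)⁻¹ / 2) with hl
  have hP : cycleLamp n m β ∈ rowStochastic ℝ (State (ZMod n) m) :=
    lamplighterChain_mem_rowStochastic (cycleWalk_mem_rowStochastic hβ0 hβ1)
  have key := le_avgOn_pow (m := m) hβ0 hβ1 (F := (cycleLamp n m β ^ (2 * s)) *ᵥ e) (l := l)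
    (fun u => by rw [← hcol]; exact (pow_mem_rowStochastic hP _).1 _ _) (by positivity)
    (fun z g => by
      rw [cycleLamp, avgOn_univ_pow]
      simp only [hav]
      simp only [mulVec, dotProduct, mul_ite, mul_one, mul_zero, Finset.sum_ite_eq',
        Finset.mem_univ, if_true]
      rw [mul_comm]
      exact mul_le_mul_of_nonneg_left (cycleWalk_pow_apply_ge hβ1 hodd hs z x')
        (by positivity)) f x t 0 ∅ (by simp)
    (fun j hj => by omega)
  have h0 : exitFun n 0 = 1 := by simp [exitFun]
  have hr := exitRate_pow_le (n := n) hβ0 hβ1 ht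
  have hu : uniform (State (ZMod n) m) (f', x') = 2 * l := by
    simp only [uniform, hl, Fintype.card_prod, Fintype.card_fun, Fintype.card_fin, ZMod.card]
    push_cast
    field_simp
  rw [avgOn_empty, mulVec_mulVec, ← pow_add, h0, Int.cast_zero, add_zero, ← hcol] at key
  have hl0 : 0 ≤ l := by positivity
  rw [hu]
  nlinarith

/-- Doeblin minorization for the lamplighter chain in time of order `n²`. -/
lemma exists_minorization (hβ0 : 0 ≤ β) (hβ1 : β < 1) : ∃ A : ℕ, 0 < A ∧
    ∀ (n m : ℕ) [NeZero n] [NeZero m], (β = 0 → Odd n) → ∀ u v : State (ZMod n) m,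
      1 / 4 * uniform (State (ZMod n) m) v ≤ (cycleLamp n m β ^ (A * n ^ 2)) u v := by
  have hβ : 0 < 1 - β := by linarith
  have hg := gapConst_pos hβ0 hβ1
  obtain ⟨A₁, h₁⟩ := exists_nat_ge (9 / 2 * Real.log 4 / (1 - β))
  obtain ⟨A₂, h₂⟩ := exists_nat_ge (Real.log 5 / 8 / gapConst β)
  rw [div_le_iff₀ hβ] at h₁
  rw [div_le_iff₀ hg] at h₂
  refine ⟨A₁ + 2 * A₂, ?_, fun n m _ _ hodd u v => ?_⟩
  · have : 0 < A₁ := by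
      have h4 : 0 < Real.log 4 := Real.log_pos (by norm_num)
      have : (0 : ℝ) < A₁ := by
        by_contra h
        nlinarith
      exact_mod_cast this
    omega
  · have e : (A₁ + 2 * A₂) * n ^ 2 = A₁ * n ^ 2 + 2 * (A₂ * n ^ 2) := by ring
    rw [e]
    refine cycleLamp_pow_apply_ge hβ0 hβ1 hodd ?_ ?_ u v <;> push_cast
    · have := mul_le_mul_of_nonneg_right h₁ (sq_nonneg (n : ℝ))
      linarith
    · have := mul_le_mul_of_nonneg_right h₂ (sq_nonneg (n : ℝ))
      linarith

end Cover

/-! ### Lower bounds of order n² from the position alone. -/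

section PositionTest

variable {n m : ℕ} [NeZero n] [NeZero m] {β ε : ℝ}

lemma sum_uniform_mul_position (f : ZMod n → ℝ) :
    ∑ s : State (ZMod n) m, uniform (State (ZMod n) m) s * f s.2 = (n : ℝ)⁻¹ * ∑ y, f y := by
  have hm : (m : ℝ) ≠ 0 := Nat.cast_ne_zero.2 (NeZero.ne m)
  have hn : (n : ℝ) ≠ 0 := Nat.cast_ne_zero.2 (NeZero.ne n)
  simp only [uniform, ← Finset.mul_sum, Fintype.sum_prod_type, Fintype.card_prod,
    Fintype.card_fun, Fintype.card_fin, ZMod.card, Finset.sum_const, Finset.card_univ,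
    nsmul_eq_mul]
  push_cast
  field_simp

lemma sum_cycleCos (hn : 3 ≤ n) : ∑ a : ZMod n, cycleCos a = 0 := by
  have h := sum_cycleCos_mul (n := n) 1
  have : Fact (1 < n) := ⟨by omega⟩
  simpa using h

lemma sum_cycleCos_sq (hn : 3 ≤ n) : ∑ a : ZMod n, cycleCos a ^ 2 = n / 2 := by
  have h := sum_cycleCos_mul (n := n) 2
  have h2 : (2 : ZMod n) ≠ 0 := by
    intro h
    have := (ZMod.natCast_eq_zero_iff 2 n).1 (by exact_mod_cast h)
    have := Nat.le_of_dvd (by norm_num) this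
    omega
  rw [if_neg h2] at h
  simp only [mul_comm _ (2 : ZMod n), cycleCos_two_mul, Finset.sum_sub_distrib,
    ← Finset.mul_sum, Finset.sum_const, Finset.card_univ, ZMod.card, nsmul_eq_mul] at h
  linarith

lemma cycleLamp_pow_mulVec_cycleCos (t : ℕ) :
    (cycleLamp n m β ^ t) *ᵥ (fun s => cycleCos s.2) =
      fun s => cycleEigenvalue β (1 : ZMod n) ^ t * cycleCos s.2 := by
  induction t with
  | zero => simp
  | succ t ih =>
    have h := cycleWalk_mulVec_cycleCos (β := β) (1 : ZMod n) 0
    simp only [one_mul, sub_zero] at h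
    rw [pow_succ', ← mulVec_mulVec, ih, cycleLamp]
    refine (lamplighterChain_mulVec_position (cycleWalk n β)
      (fun y => cycleEigenvalue β (1 : ZMod n) ^ t * cycleCos y)).trans ?_
    have h2 : (fun y : ZMod n => cycleEigenvalue β (1 : ZMod n) ^ t * cycleCos y) =
        (cycleEigenvalue β (1 : ZMod n) ^ t) • (fun y : ZMod n => cycleCos y) := rfl
    rw [h2, mulVec_smul, h]
    funext s
    simp only [Pi.smul_apply, smul_eq_mul]
    ring

lemma sum_pow_mul_cycleCos (t : ℕ) (f : ZMod n → Fin m) :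
    ∑ s, (cycleLamp n m β ^ t) (f, 0) s * cycleCos s.2 =
      cycleEigenvalue β (1 : ZMod n) ^ t := by
  have := congrFun (cycleLamp_pow_mulVec_cycleCos (n := n) (m := m) (β := β) t) (f, 0)
  simpa [cycleCos_zero, mulVec, dotProduct] using this

lemma abs_cycleEigenvalue_le_one (hβ0 : 0 ≤ β) (hβ1 : β < 1) (a : ZMod n) :
    |cycleEigenvalue β a| ≤ 1 := by
  have := abs_le.1 (abs_cycleCos_le_one a)
  rw [abs_le, cycleEigenvalue]
  constructor <;> nlinarith

/-- Bernoulli's inequality, which allows a negative eigenvalue as long as it is at least -1; the 20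
bounds 2π². -/
lemma one_sub_le_cycleEigenvalue_pow (hβ0 : 0 ≤ β) (hβ1 : β < 1) (j : ℕ) :
    1 - 20 * j / (n : ℝ) ^ 2 ≤ cycleEigenvalue β (1 : ZMod n) ^ j := by
  have hn : (0 : ℝ) < n := Nat.cast_pos.2 (NeZero.pos n)
  have h1 := (abs_le.1 (abs_cycleEigenvalue_le_one (n := n) hβ0 hβ1 1)).1
  have h2 := one_add_mul_le_pow (a := cycleEigenvalue β (1 : ZMod n) - 1) (by linarith) j
  rw [add_sub_cancel] at h2
  refine le_trans ?_ h2
  have h3 : cycleCos (1 : ZMod n) = Real.cos (2 * Real.pi / n) := by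
    have := cycleCos_natCast (n := n) 1
    simpa using this
  have h4 := Real.one_sub_sq_div_two_le_cos (x := 2 * Real.pi / n)
  have h5 : (2 * Real.pi / n) ^ 2 / 2 ≤ 20 / (n : ℝ) ^ 2 := by
    rw [div_pow, div_div, mul_comm ((n : ℝ) ^ 2), ← div_div]
    refine div_le_div_of_nonneg_right ?_ (by positivity)
    nlinarith [Real.pi_lt_d2, Real.pi_pos]
  have h6 : -(20 / (n : ℝ) ^ 2) ≤ cycleEigenvalue β (1 : ZMod n) - 1 := by
    rw [cycleEigenvalue, h3]
    nlinarith [Real.cos_le_one (2 * Real.pi / n)]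
  have h7 := mul_le_mul_of_nonneg_left h6 (Nat.cast_nonneg (α := ℝ) j)
  have h8 : 20 * (j : ℝ) / (n : ℝ) ^ 2 = j * (20 / (n : ℝ) ^ 2) := by ring
  linarith

/-- Shared end of the three arguments: total variation uses j = t, while entropy and L² control the
squared mean of the cosine and use j = 2t. -/
lemma sq_le_of_cycleEigenvalue_pow_le (hβ0 : 0 ≤ β) (hβ1 : β < 1) {t j : ℕ} (hj : j ≤ 2 * t)
    (h : cycleEigenvalue β (1 : ZMod n) ^ j ≤ 2 * ε) : (1 - 2 * ε) / 40 * (n : ℝ) ^ 2 ≤ t := by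
  have hn : (0 : ℝ) < (n : ℝ) ^ 2 := pow_pos (Nat.cast_pos.2 (NeZero.pos n)) 2
  have h1 := (one_sub_le_cycleEigenvalue_pow (n := n) hβ0 hβ1 j).trans h
  have h2 : 1 - 2 * ε ≤ 20 * j / (n : ℝ) ^ 2 := by linarith
  rw [le_div_iff₀ hn] at h2
  have : (j : ℝ) ≤ 2 * t := by exact_mod_cast hj
  linarith

lemma cycleLamp_mem_rowStochastic (hβ0 : 0 ≤ β) (hβ1 : β < 1) :
    cycleLamp n m β ∈ rowStochastic ℝ (State (ZMod n) m) :=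
  lamplighterChain_mem_rowStochastic (cycleWalk_mem_rowStochastic hβ0 hβ1)

lemma sq_le_of_tvDist_le (hβ0 : 0 ≤ β) (hβ1 : β < 1) (hn : 3 ≤ n) {t : ℕ}
    {f : ZMod n → Fin m}
    (h : tvDist ((cycleLamp n m β ^ t) (f, 0)) (cyclePi n m) ≤ ε) :
    (1 - 2 * ε) / 40 * (n : ℝ) ^ 2 ≤ t := by
  have hP := pow_mem_rowStochastic (cycleLamp_mem_rowStochastic (n := n) (m := m) hβ0 hβ1) t
  have h1 := sum_mul_sub_sum_mul_le_tvDist (μ := (cycleLamp n m β ^ t) (f, 0))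
    (π := cyclePi n m) (F := fun s => cycleCos s.2)
    ((sum_row_of_mem_rowStochastic hP _).trans sum_uniform.symm)
    (fun s => abs_cycleCos_le_one _)
  rw [sum_pow_mul_cycleCos, cyclePi, sum_uniform_mul_position, sum_cycleCos hn] at h1
  rw [cyclePi] at h
  exact sq_le_of_cycleEigenvalue_pow_le hβ0 hβ1 (j := t) (by omega) (by linarith)

lemma sq_le_of_relEntropy_le (hβ0 : 0 ≤ β) (hβ1 : β < 1) (hn : 3 ≤ n) {t : ℕ}
    {f : ZMod n → Fin m}
    (h : relEntropy ((cycleLamp n m β ^ t) (f, 0)) (cyclePi n m) ≤ ε) :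
    (1 - 2 * ε) / 40 * (n : ℝ) ^ 2 ≤ t := by
  have hn0 : (n : ℝ) ≠ 0 := Nat.cast_ne_zero.2 (NeZero.ne n)
  have hP := pow_mem_rowStochastic (cycleLamp_mem_rowStochastic (n := n) (m := m) hβ0 hβ1) t
  set θ := cycleEigenvalue β (1 : ZMod n) ^ t with hθ
  have hθ1 : |θ| ≤ 1 := by
    rw [hθ, abs_pow]
    exact pow_le_one₀ (abs_nonneg _) (abs_cycleEigenvalue_le_one hβ0 hβ1 1)
  -- Tilting by θ cos, with θ the mean of the cosine at time t, has log-moment at most θ²/2, since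
  -- exp u ≤ 1 + u + u² for |u| ≤ 1. Hence θ² ≤ ε + θ²/2.
  have h1 := sum_mul_le_relEntropy_add_log (μ := (cycleLamp n m β ^ t) (f, 0))
    (π := cyclePi n m) (fun s => θ * cycleCos s.2) (fun s => hP.1 _ _)
    (fun s => uniform_pos s) (sum_row_of_mem_rowStochastic hP _)
  have h2 : ∑ s, (cycleLamp n m β ^ t) (f, 0) s * (θ * cycleCos s.2) = θ ^ 2 := by
    have := sum_pow_mul_cycleCos (β := β) t f
    rw [← hθ] at this
    calc _ = θ * ∑ s, (cycleLamp n m β ^ t) (f, 0) s * cycleCos s.2 := by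
          rw [Finset.mul_sum]; exact Finset.sum_congr rfl fun _ _ => by ring
      _ = _ := by rw [this]; ring
  have h3 : ∑ s, cyclePi n m s * Real.exp (θ * cycleCos s.2) ≤ 1 + θ ^ 2 / 2 := by
    rw [cyclePi, sum_uniform_mul_position (fun y => Real.exp (θ * cycleCos y))]
    have h4 : ∑ y : ZMod n, Real.exp (θ * cycleCos y) ≤
        ∑ y : ZMod n, (1 + θ * cycleCos y + θ ^ 2 * cycleCos y ^ 2) := by
      refine Finset.sum_le_sum fun y _ => ?_
      have h5 : |θ * cycleCos y| ≤ 1 := by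
        rw [abs_mul]
        exact mul_le_one₀ hθ1 (abs_nonneg _) (abs_cycleCos_le_one y)
      have h6 := (abs_le.1 (Real.abs_exp_sub_one_sub_id_le h5)).2
      rw [mul_pow] at h6
      linarith
    rw [Finset.sum_add_distrib, Finset.sum_add_distrib, ← Finset.mul_sum, ← Finset.mul_sum,
      sum_cycleCos hn, sum_cycleCos_sq hn] at h4
    refine (mul_le_mul_of_nonneg_left h4 (by positivity)).trans_eq ?_
    simp only [Finset.sum_const, Finset.card_univ, ZMod.card, nsmul_eq_mul]
    field_simp
    ring
  have h3' : 0 < ∑ s, cyclePi n m s * Real.exp (θ * cycleCos s.2) :=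
    Finset.sum_pos (fun s _ => mul_pos (uniform_pos s) (Real.exp_pos _)) Finset.univ_nonempty
  have h5 : Real.log (∑ s, cyclePi n m s * Real.exp (θ * cycleCos s.2)) ≤ θ ^ 2 / 2 :=
    (Real.log_le_sub_one_of_pos h3').trans (by linarith)
  rw [h2] at h1
  refine sq_le_of_cycleEigenvalue_pow_le hβ0 hβ1 (j := 2 * t) le_rfl ?_
  rw [mul_comm, pow_mul, ← hθ]
  linarith

lemma sq_le_of_l2Dist_le (hβ0 : 0 ≤ β) (hβ1 : β < 1) (hε0 : 0 < ε) (hε1 : ε < 1 / 2)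
    (hn : 3 ≤ n) {t : ℕ} {f : ZMod n → Fin m}
    (h : l2Dist ((cycleLamp n m β ^ t) (f, 0)) (cyclePi n m) ≤ ε) :
    (1 - 2 * ε) / 40 * (n : ℝ) ^ 2 ≤ t := by
  have hn0 : (n : ℝ) ≠ 0 := Nat.cast_ne_zero.2 (NeZero.ne n)
  have h1 := sq_sum_mul_sub_le_l2Dist_sq (μ := (cycleLamp n m β ^ t) (f, 0))
    (π := cyclePi n m) (fun s => cycleCos s.2) (fun s => uniform_pos s)
  rw [sum_pow_mul_cycleCos, cyclePi, sum_uniform_mul_position, sum_cycleCos hn,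
    sum_uniform_mul_position (fun y => cycleCos y ^ 2), sum_cycleCos_sq hn, mul_zero,
    sub_zero] at h1
  have h2 : (n : ℝ)⁻¹ * (n / 2) = 1 / 2 := by field_simp
  rw [h2] at h1
  have h3 : l2Dist ((cycleLamp n m β ^ t) (f, 0)) (cyclePi n m) ^ 2 ≤ ε ^ 2 :=
    pow_le_pow_left₀ (Real.sqrt_nonneg _) h 2
  rw [cyclePi] at h3
  refine sq_le_of_cycleEigenvalue_pow_le hβ0 hβ1 (j := 2 * t) le_rfl ?_
  rw [mul_comm, pow_mul]
  nlinarith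

end PositionTest

/-! ### The probability that a set of lamps is untouched. -/

section UnvisitedLamps

variable {V : Type*} [Fintype V] [DecidableEq V] {m : ℕ}

/-- Indicator of the states whose lamps in `J` agree with `f`. -/
def agreeOn (J : Finset V) (f : V → Fin m) (s : State V m) : ℝ :=
  if ∀ v ∈ J, s.1 v = f v then 1 else 0

lemma agreeOn_nonneg (J : Finset V) (f : V → Fin m) (s : State V m) : 0 ≤ agreeOn J f s := by
  unfold agreeOn; split_ifs <;> norm_num

lemma sum_uniform_mul_agreeOn [Nonempty V] [NeZero m] (J : Finset V) (f : V → Fin m) :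
    ∑ s : State V m, uniform (State V m) s * agreeOn J f s = ((m : ℝ) ^ J.card)⁻¹ := by
  have hm : (m : ℝ) ≠ 0 := Nat.cast_ne_zero.2 (NeZero.ne m)
  have hV : (Fintype.card V : ℝ) ≠ 0 := Nat.cast_ne_zero.2 Fintype.card_ne_zero
  have hset : (Finset.univ.filter fun g : V → Fin m => ∀ v ∈ J, g v = f v) =
      Fintype.piFinset fun v => if v ∈ J then {f v} else Finset.univ := by
    ext g
    simp only [Finset.mem_filter, Finset.mem_univ, true_and, Fintype.mem_piFinset]
    refine forall_congr' fun v => ?_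
    by_cases hv : v ∈ J <;> simp [hv]
  have hcard : ((Finset.univ.filter fun g : V → Fin m => ∀ v ∈ J, g v = f v).card : ℝ) *
      (m : ℝ) ^ J.card = (m : ℝ) ^ Fintype.card V := by
    rw [hset, Fintype.card_piFinset]
    have : ∀ v, (if v ∈ J then ({f v} : Finset (Fin m)) else Finset.univ).card =
        if v ∈ J then 1 else m := fun v => by split_ifs <;> simp
    simp only [this]
    rw [Finset.prod_ite]
    simp only [Finset.prod_const, one_pow, one_mul]
    push_cast
    rw [← pow_add]
    congr 1
    have := Finset.card_filter_add_card_filter_not (s := (Finset.univ : Finset V))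
      (fun v => v ∈ J)
    simp only [Finset.filter_univ_mem, Finset.card_univ] at this
    omega
  have hsum : ∑ s : State V m, agreeOn J f s = Fintype.card V *
      ((Finset.univ.filter fun g : V → Fin m => ∀ v ∈ J, g v = f v).card : ℝ) := by
    rw [Fintype.sum_prod_type_right]
    simp only [agreeOn, Finset.sum_boole, Finset.sum_const, Finset.card_univ, nsmul_eq_mul]
  simp only [uniform, ← Finset.mul_sum, hsum, Fintype.card_prod, Fintype.card_fun,
    Fintype.card_fin]
  push_cast
  rw [← hcard]
  have : ((Finset.univ.filter fun g : V → Fin m => ∀ v ∈ J, g v = f v).card : ℝ) ≠ 0 := by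
    intro h
    rw [h, zero_mul] at hcard
    exact (pow_ne_zero _ hm) hcard.symm
  field_simp

/-- A function `h` with `ρ h ≤ P h` for the base chain that vanishes on `J` gives a lower bound on the
probability that the lamps in `J` have not been touched. -/
lemma pow_mul_le_sum_agreeOn [NeZero m] {P : Matrix V V ℝ} (hP : P ∈ rowStochastic ℝ V)
    {J : Finset V} {h : V → ℝ} {ρ : ℝ} (hρ : 0 ≤ ρ) (h0 : ∀ v, 0 ≤ h v) (h1 : ∀ v, h v ≤ 1)
    (hJ : ∀ v ∈ J, h v = 0) (hh : ∀ v, ρ * h v ≤ (P *ᵥ h) v) (f : V → Fin m) (x : V) (t : ℕ) :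
    ρ ^ t * h x ≤ ∑ s, (lamplighterChain P m ^ t) (f, x) s * agreeOn J f s := by
  set H : State V m → ℝ := fun s => agreeOn J f s * h s.2 with hH
  have hH0 : ∀ s, 0 ≤ H s := fun s => mul_nonneg (agreeOn_nonneg _ _ _) (h0 _)
  have hL := lamplighterChain_mem_rowStochastic (m := m) hP
  -- The product of agreement and h inherits the subsolution property. On J it vanishes; off J, a
  -- move into J is killed by h = 0, and any other move randomizes only lamps outside J and
  -- preserves agreement.
  have step : ∀ s, ρ * H s ≤ (lamplighterChain P m *ᵥ H) s := by
    rintro ⟨g, y⟩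
    by_cases hy : y ∈ J
    · have : H (g, y) = 0 := by simp [hH, hJ y hy]
      rw [this, mul_zero]
      exact nonneg_mulVec_of_mem_rowStochastic hL hH0 _
    · rw [lamplighterChain_mulVec_eq]
      have hz : ∀ z, avgOn (insert z {y}) (fun g => H (g, z)) g = agreeOn J f (g, y) * h z := by
        intro z
        refine avgOn_const_of_forall fun k => ?_
        by_cases hz : z ∈ J
        · simp [hH, hJ z hz]
        · simp only [hH, agreeOn]
          congr 2
          refine propext (forall₂_congr fun v hv => ?_)
          have hvz : v ≠ z := fun e => hz (e ▸ hv)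
          have hvy : v ≠ y := fun e => hy (e ▸ hv)
          simp [Finset.piecewise, hvz, hvy]
      simp only [hz]
      have := mul_le_mul_of_nonneg_left (hh y) (agreeOn_nonneg J f (g, y))
      calc ρ * H (g, y) = agreeOn J f (g, y) * (ρ * h y) := by simp only [hH]; ring
        _ ≤ _ := this
        _ = _ := by
          simp only [mulVec, dotProduct, Finset.mul_sum]
          exact Finset.sum_congr rfl fun _ _ => by ring
  have main : ∀ t s, ρ ^ t * H s ≤ ((lamplighterChain P m ^ t) *ᵥ H) s := by
    intro t
    induction t with
    | zero => simp
    | succ t ih =>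
      intro s
      rw [pow_succ' (lamplighterChain P m), ← mulVec_mulVec]
      calc ρ ^ (t + 1) * H s = ρ ^ t * (ρ * H s) := by ring
        _ ≤ ρ ^ t * (lamplighterChain P m *ᵥ H) s :=
          mul_le_mul_of_nonneg_left (step s) (pow_nonneg hρ t)
        _ = ∑ s', lamplighterChain P m s s' * (ρ ^ t * H s') := by
          simp only [mulVec, dotProduct, Finset.mul_sum]
          exact Finset.sum_congr rfl fun _ _ => by ring
        _ ≤ _ := Finset.sum_le_sum fun s' _ => mul_le_mul_of_nonneg_left (ih s') (hL.1 _ _)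
  have hx : H (f, x) = h x := by simp [hH, agreeOn]
  rw [← hx]
  refine (main t _).trans (Finset.sum_le_sum fun s _ =>
    mul_le_mul_of_nonneg_left ?_ ((pow_mem_rowStochastic hL t).1 _ _))
  exact mul_le_of_le_one_right (agreeOn_nonneg _ _ _) (h1 _)

end UnvisitedLamps

/-! ### Untouched lamps on half of the cycle: entropy and L² lower bounds. -/

section Arc

variable {n m : ℕ} [NeZero n] [NeZero m] {β ε : ℝ}

/-- The arc of the cycle on which the lamps are kept untouched. -/
def farArc (n : ℕ) [NeZero n] : Finset (ZMod n) :=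
  Finset.univ.filter fun v => (n + 1) / 2 ≤ v.val

/-- Dirichlet eigenfunction of the complement of `farArc`. -/
def survFun (n : ℕ) (v : ZMod n) : ℝ :=
  if v.val < (n + 1) / 2 then
    Real.sin (Real.pi * (v.val + 1) / (((n + 1) / 2 : ℕ) + 1)) else 0

/-- The eigenvalue of `survFun`. -/
def survRate (β : ℝ) (n : ℕ) : ℝ :=
  β + (1 - β) * Real.cos (Real.pi / (((n + 1) / 2 : ℕ) + 1))

lemma card_farArc : (farArc n).card = n - (n + 1) / 2 := by
  have : (farArc n).card = (Finset.Ico ((n + 1) / 2) n).card := by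
    refine Finset.card_nbij' ZMod.val (fun j => (j : ZMod n)) ?_ ?_ ?_ ?_
    · intro v hv
      simp only [farArc, Finset.coe_filter, Finset.mem_univ, true_and, Set.mem_ofPred_eq] at hv
      simpa using ⟨hv, ZMod.val_lt v⟩
    · intro j hj
      simp only [Finset.coe_Ico, Set.mem_Ico] at hj
      simp [farArc, ZMod.val_cast_of_lt hj.2, hj.1]
    · intro v _; simp
    · intro j hj
      simp only [Finset.coe_Ico, Set.mem_Ico] at hj
      exact ZMod.val_cast_of_lt hj.2
  rw [this, Nat.card_Ico]

lemma survFun_natCast {n : ℕ} {j : ℕ} (hj : j < n) : survFun n (j : ZMod n) =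
    if j < (n + 1) / 2 then Real.sin (Real.pi * (j + 1) / (((n + 1) / 2 : ℕ) + 1)) else 0 := by
  rw [survFun, ZMod.val_cast_of_lt hj]

lemma survFun_nonneg {n : ℕ} (v : ZMod n) : 0 ≤ survFun n v := by
  unfold survFun
  split_ifs with h
  · have h' : (v.val : ℝ) + 1 ≤ ((n + 1) / 2 : ℕ) := by exact_mod_cast h
    refine Real.sin_nonneg_of_nonneg_of_le_pi (by positivity) ?_
    rw [div_le_iff₀ (by positivity)]
    exact mul_le_mul_of_nonneg_left (by linarith) Real.pi_pos.le
  · exact le_rfl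

lemma survFun_le_one {n : ℕ} (v : ZMod n) : survFun n v ≤ 1 := by
  unfold survFun
  split_ifs
  · exact Real.sin_le_one _
  · exact zero_le_one

/-- With L = (n + 1) / 2, the sine vanishes at -1 and at L, matching the value 0 on `farArc`, so
equality holds on the arc 0, …, L - 1. On `farArc` the left side is 0. -/
lemma survRate_mul_survFun_le (hn : 3 ≤ n) (hβ0 : 0 ≤ β) (hβ1 : β < 1) (v : ZMod n) :
    survRate β n * survFun n v ≤ (cycleWalk n β *ᵥ survFun n) v := by
  have hP := cycleWalk_mem_rowStochastic (n := n) hβ0 hβ1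
  have hv := ZMod.val_lt v
  obtain ⟨k, hk⟩ : ∃ k, k = v.val := ⟨_, rfl⟩
  have hvk : v = (k : ZMod n) := by rw [hk, ZMod.natCast_zmod_val]
  rw [← hk] at hv
  clear hk
  subst hvk
  set L := (n + 1) / 2 with hL
  have hLn : L < n := by omega
  by_cases hkL : k < L
  · apply le_of_eq
    have hL0 : ((L : ℝ) + 1) ≠ 0 := by positivity
    have e0 : survFun n (k : ZMod n) = Real.sin (Real.pi * (k + 1) / (L + 1)) := by
      rw [survFun_natCast hv, if_pos hkL]
    have e1 : survFun n ((k : ZMod n) + 1) =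
        Real.sin (Real.pi * (k + 1) / (L + 1) + Real.pi / (L + 1)) := by
      rw [← Nat.cast_succ, survFun_natCast (by omega), ← hL]
      split_ifs with h
      · congr 1; push_cast; ring
      · have : k + 1 = L := by omega
        rw [← this, ← Real.sin_pi]
        congr 1
        push_cast
        field_simp
    have e2 : survFun n ((k : ZMod n) - 1) =
        Real.sin (Real.pi * (k + 1) / (L + 1) - Real.pi / (L + 1)) := by
      rcases Nat.eq_zero_or_pos k with rfl | hk0
      -- The left neighbour of 0 wraps around to n - 1, which lies in `farArc` as L < n.
      · have : ((0 : ℕ) : ZMod n) - 1 = ((n - 1 : ℕ) : ZMod n) := by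
          push_cast [Nat.cast_sub (show 1 ≤ n by omega)]; simp
        rw [this, survFun_natCast (by omega), if_neg (by omega)]
        simp
      · have : (k : ZMod n) - 1 = ((k - 1 : ℕ) : ZMod n) := by
          push_cast [Nat.cast_sub hk0]; rfl
        rw [this, survFun_natCast (by omega), if_pos (by omega)]
        congr 1
        push_cast [Nat.cast_sub hk0]
        ring
    rw [cycleWalk_mulVec, e0, e1, e2, Real.sin_add, Real.sin_sub, survRate, ← hL]
    ring
  · rw [survFun_natCast hv, if_neg hkL, mul_zero]
    exact nonneg_mulVec_of_mem_rowStochastic hP survFun_nonneg _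

/-- The starting point is near the middle of the arc: the phase lies in [π/2, 2π/3], and Jordan's
inequality after reflection gives 2/3. -/
lemma half_le_survFun {n : ℕ} (hn : 3 ≤ n) :
    1 / 2 ≤ survFun n (((n + 1) / 4 : ℕ) : ZMod n) := by
  rw [survFun_natCast (by omega), if_pos (by omega)]
  set L := (n + 1) / 2 with hL
  set k := (n + 1) / 4 with hk
  have hL0 : (0 : ℝ) < (L : ℝ) + 1 := by positivity
  have h1 : (L : ℝ) + 1 ≤ 2 * (k + 1) := by
    have : L + 1 ≤ 2 * (k + 1) := by omega
    exact_mod_cast this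
  have h2 : 3 * ((k : ℝ) + 1) ≤ 2 * (L + 1) := by
    have : 3 * (k + 1) ≤ 2 * (L + 1) := by omega
    exact_mod_cast this
  have hπ := Real.pi_pos
  rw [← Real.sin_pi_sub]
  have h3 : Real.pi * (k + 1) / (L + 1) ≤ Real.pi * (2 / 3) := by
    rw [div_le_iff₀ hL0]; nlinarith
  have h4 : Real.pi / 2 ≤ Real.pi * (k + 1) / (L + 1) := by
    rw [le_div_iff₀ hL0]; nlinarith
  have h5 := Real.mul_le_sin (x := Real.pi - Real.pi * (k + 1) / (L + 1)) (by linarith)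
    (by linarith)
  refine le_trans ?_ h5
  have h6 : 2 / Real.pi * (Real.pi / 3) ≤
      2 / Real.pi * (Real.pi - Real.pi * (k + 1) / (L + 1)) :=
    mul_le_mul_of_nonneg_left (by linarith) (by positivity)
  have h7 : 2 / Real.pi * (Real.pi / 3) = 2 / 3 := by field_simp
  linarith

/-- Since L + 1 ≥ n/2, the cosine c satisfies 1 - c ≤ 20/n², and c ≥ 1/2 gives log c ≥ -2(1 - c).
Holding only moves the rate closer to 1. -/
lemma exp_le_survRate (hn : 3 ≤ n) (hβ0 : 0 ≤ β) :
    Real.exp (-(40 / (n : ℝ) ^ 2)) ≤ survRate β n := by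
  have hn0 : (0 : ℝ) < n := by exact_mod_cast NeZero.pos n
  unfold survRate
  set L := (n + 1) / 2 with hL
  have hL2 : (2 : ℝ) ≤ L := by
    have : 2 ≤ L := by omega
    exact_mod_cast this
  have hLn : (n : ℝ) ≤ 2 * (L + 1) := by
    have : n ≤ 2 * (L + 1) := by omega
    exact_mod_cast this
  have hπ := Real.pi_pos
  set c := Real.cos (Real.pi / (L + 1)) with hc
  have h1 : 1 / 2 ≤ c := by
    rw [hc, ← Real.cos_pi_div_three]
    refine Real.cos_le_cos_of_nonneg_of_le_pi (by positivity) (by linarith) ?_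
    exact div_le_div_of_nonneg_left hπ.le (by norm_num) (by linarith)
  have h2 : 1 - c ≤ 20 / (n : ℝ) ^ 2 := by
    have h := Real.one_sub_sq_div_two_le_cos (x := Real.pi / (L + 1))
    have h' : (Real.pi / (L + 1)) ^ 2 / 2 ≤ 20 / (n : ℝ) ^ 2 := by
      rw [div_pow, div_div, div_le_div_iff₀ (by positivity) (by positivity)]
      have hp : Real.pi ^ 2 ≤ 10 := by nlinarith [Real.pi_lt_d2]
      have hn2 : (n : ℝ) ^ 2 ≤ (2 * (L + 1)) ^ 2 := pow_le_pow_left₀ hn0.le hLn 2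
      calc Real.pi ^ 2 * (n : ℝ) ^ 2 ≤ 10 * (2 * (L + 1)) ^ 2 :=
            mul_le_mul hp hn2 (by positivity) (by norm_num)
        _ = _ := by ring
    linarith
  have h3 : c ≤ β + (1 - β) * c := by nlinarith [Real.cos_le_one (Real.pi / (L + 1))]
  refine le_trans ?_ h3
  have hc0 : 0 < c := by linarith
  rw [← Real.le_log_iff_exp_le hc0]
  have h4 := Real.one_sub_inv_le_log_of_pos hc0
  have h5 : c⁻¹ - 1 ≤ 2 * (1 - c) := by
    have : c⁻¹ - 1 = (1 - c) / c := by field_simp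
    rw [this, div_le_iff₀ hc0]
    nlinarith [Real.cos_le_one (Real.pi / (L + 1))]
  have h6 : 40 / (n : ℝ) ^ 2 = 2 * (20 / (n : ℝ) ^ 2) := by ring
  linarith

lemma exp_le_sum_agreeOn_farArc (hn : 3 ≤ n) (hβ0 : 0 ≤ β) (hβ1 : β < 1)
    (f : ZMod n → Fin m) (t : ℕ) :
    Real.exp (-(40 * t / (n : ℝ) ^ 2)) / 2 ≤
      ∑ s, (cycleLamp n m β ^ t) (f, (((n + 1) / 4 : ℕ) : ZMod n)) s *
        agreeOn (farArc n) f s := by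
  have hr := exp_le_survRate hn hβ0
  have hr0 : 0 ≤ survRate β n := (Real.exp_pos _).le.trans hr
  refine le_trans ?_ (pow_mul_le_sum_agreeOn (cycleWalk_mem_rowStochastic hβ0 hβ1) hr0
    survFun_nonneg survFun_le_one (fun v hv => ?_) (survRate_mul_survFun_le hn hβ0 hβ1) f _ t)
  · rw [div_eq_mul_inv, ← one_div]
    refine mul_le_mul ?_ (half_le_survFun hn) (by norm_num) (pow_nonneg hr0 t)
    refine le_trans (le_of_eq ?_) (pow_le_pow_left₀ (Real.exp_pos _).le hr t)
    rw [← Real.exp_nat_mul]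
    congr 1; ring
  · rw [farArc, Finset.mem_filter] at hv
    rw [survFun, if_neg (not_lt.2 hv.2)]

lemma third_le_card_farArc (hn : 3 ≤ n) : (n : ℝ) / 3 ≤ (farArc n).card := by
  have : n ≤ 3 * (farArc n).card := by rw [card_farArc]; omega
  have : (n : ℝ) ≤ 3 * (farArc n).card := by exact_mod_cast this
  linarith

/-- Donsker–Varadhan with a = |J| log m times the indicator of agreement on J = `farArc n`. This a
makes exp a the inverse of the stationary mass of the event, so the exponential moment is at most 2
and a times the probability of agreement is at most 2. -/
lemma log_le_of_relEntropy_le (hn : 3 ≤ n) (hm : 2 ≤ m) (hβ0 : 0 ≤ β) (hβ1 : β < 1)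
    (hε1 : ε < 1 / 2) {f : ZMod n → Fin m} {t : ℕ}
    (h : relEntropy ((cycleLamp n m β ^ t) (f, (((n + 1) / 4 : ℕ) : ZMod n)))
      (cyclePi n m) ≤ ε) :
    (n : ℝ) ^ 2 * (Real.log (n * Real.log m) - Real.log 12) ≤ 40 * t := by
  have hn0 : (0 : ℝ) < n := by exact_mod_cast NeZero.pos n
  have hm0 : (0 : ℝ) < m := by exact_mod_cast NeZero.pos m
  have hlm : 0 < Real.log m := Real.log_pos (by exact_mod_cast hm)
  have hP := pow_mem_rowStochastic (cycleLamp_mem_rowStochastic (n := n) (m := m) hβ0 hβ1) t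
  set x : ZMod n := (((n + 1) / 4 : ℕ) : ZMod n) with hx
  set a : ℝ := (farArc n).card * Real.log m with ha
  have ha0 : (n : ℝ) / 3 * Real.log m ≤ a :=
    mul_le_mul_of_nonneg_right (third_le_card_farArc hn) hlm.le
  have h1 := sum_mul_le_relEntropy_add_log (μ := (cycleLamp n m β ^ t) (f, x))
    (π := cyclePi n m) (fun s => a * agreeOn (farArc n) f s) (fun s => hP.1 _ _)
    (fun s => uniform_pos s) (sum_row_of_mem_rowStochastic hP _)
  have hexp : Real.exp a = (m : ℝ) ^ (farArc n).card := by
    rw [ha, Real.exp_nat_mul, Real.exp_log hm0]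
  have h2 : ∑ s, cyclePi n m s * Real.exp (a * agreeOn (farArc n) f s) ≤ 2 := by
    have h3 : ∀ s, cyclePi n m s * Real.exp (a * agreeOn (farArc n) f s) ≤
        cyclePi n m s + Real.exp a * (uniform (State (ZMod n) m) s * agreeOn (farArc n) f s) := by
      intro s
      have hs : 0 < cyclePi n m s := uniform_pos s
      rw [← cyclePi]
      unfold agreeOn
      split_ifs
      · rw [mul_one, mul_one]
        linarith [mul_comm (cyclePi n m s) (Real.exp a)]
      · simp
    refine (Finset.sum_le_sum fun s _ => h3 s).trans_eq ?_
    rw [Finset.sum_add_distrib, ← Finset.mul_sum, sum_uniform_mul_agreeOn, hexp,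
      mul_inv_cancel₀ (by positivity), cyclePi, sum_uniform]
    norm_num
  have h2' : 0 < ∑ s, cyclePi n m s * Real.exp (a * agreeOn (farArc n) f s) :=
    Finset.sum_pos (fun s _ => mul_pos (uniform_pos s) (Real.exp_pos _)) Finset.univ_nonempty
  have h4 := Real.log_le_sub_one_of_pos h2'
  have h5 := exp_le_sum_agreeOn_farArc (m := m) hn hβ0 hβ1 f t
  rw [← hx] at h5
  have h6 : ∑ s, (cycleLamp n m β ^ t) (f, x) s * (a * agreeOn (farArc n) f s) =
      a * ∑ s, (cycleLamp n m β ^ t) (f, x) s * agreeOn (farArc n) f s := by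
    rw [Finset.mul_sum]; exact Finset.sum_congr rfl fun _ _ => by ring
  rw [h6] at h1
  have h7 : (n : ℝ) / 3 * Real.log m * (Real.exp (-(40 * t / (n : ℝ) ^ 2)) / 2) ≤ 2 :=
    (mul_le_mul ha0 h5 (by positivity) (le_trans (by positivity) ha0)).trans (by linarith)
  have h8 : (n : ℝ) * Real.log m ≤ 12 * Real.exp (40 * t / (n : ℝ) ^ 2) := by
    rw [Real.exp_neg] at h7
    have he := Real.exp_pos (40 * t / (n : ℝ) ^ 2)
    have h9 := mul_le_mul_of_nonneg_right h7 he.le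
    have : (n : ℝ) / 3 * Real.log m * ((Real.exp (40 * t / (n : ℝ) ^ 2))⁻¹ / 2) *
        Real.exp (40 * t / (n : ℝ) ^ 2) = n * Real.log m / 6 := by field_simp; norm_num
    linarith
  have h9 := Real.log_le_log (by positivity) h8
  rw [Real.log_mul (by norm_num) (Real.exp_pos _).ne', Real.log_exp] at h9
  have h10 : Real.log (n * Real.log m) - Real.log 12 ≤ 40 * t / (n : ℝ) ^ 2 := by linarith
  rw [le_div_iff₀ (by positivity)] at h10
  linarith

/-- With b = |J| log m / 2, the stationary mass of agreement is exp(-2b). Cauchy–Schwarz bounds its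
probability at time t by exp(-2b) + ε exp(-b) ≤ 2 exp(-b), which is compared with exp(-40t/n²)/2. -/
lemma log_le_of_l2Dist_le (hn : 3 ≤ n) (hm : 2 ≤ m) (hβ0 : 0 ≤ β) (hβ1 : β < 1)
    (hε1 : ε < 1 / 2) {f : ZMod n → Fin m} {t : ℕ}
    (h : l2Dist ((cycleLamp n m β ^ t) (f, (((n + 1) / 4 : ℕ) : ZMod n)))
      (cyclePi n m) ≤ ε) :
    (n : ℝ) ^ 2 * (n * Real.log m / 6 - Real.log 4) ≤ 40 * t := by
  have hn0 : (0 : ℝ) < n := by exact_mod_cast NeZero.pos n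
  have hm0 : (0 : ℝ) < m := by exact_mod_cast NeZero.pos m
  have hlm : 0 < Real.log m := Real.log_pos (by exact_mod_cast hm)
  set x : ZMod n := (((n + 1) / 4 : ℕ) : ZMod n) with hx
  set b : ℝ := (farArc n).card * Real.log m / 2 with hb
  have hb0 : (n : ℝ) * Real.log m / 6 ≤ b := by
    have := mul_le_mul_of_nonneg_right (third_le_card_farArc hn) hlm.le
    rw [hb]; linarith
  have hexp : ((m : ℝ) ^ (farArc n).card)⁻¹ = Real.exp (-b) ^ 2 := by
    rw [← Real.exp_nat_mul, hb, show ((2 : ℕ) : ℝ) * -((farArc n).card * Real.log m / 2) =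
      -((farArc n).card * Real.log m) by push_cast; ring, Real.exp_neg, Real.exp_nat_mul,
      Real.exp_log hm0]
  have h1 := sq_sum_mul_sub_le_l2Dist_sq (μ := (cycleLamp n m β ^ t) (f, x))
    (π := cyclePi n m) (agreeOn (farArc n) f) (fun s => uniform_pos s)
  have hsq : ∀ s, agreeOn (farArc n) f s ^ 2 = agreeOn (farArc n) f s := by
    intro s; unfold agreeOn; split_ifs <;> norm_num
  simp only [hsq] at h1
  have h5 := exp_le_sum_agreeOn_farArc (m := m) hn hβ0 hβ1 f t
  rw [← hx] at h5
  set μA := ∑ s, (cycleLamp n m β ^ t) (f, x) s * agreeOn (farArc n) f s with hμ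
  have h2 : ∑ s, cyclePi n m s * agreeOn (farArc n) f s = Real.exp (-b) ^ 2 := by
    rw [cyclePi, sum_uniform_mul_agreeOn, hexp]
  rw [h2] at h1
  have hd0 : 0 ≤ l2Dist ((cycleLamp n m β ^ t) (f, x)) (cyclePi n m) := Real.sqrt_nonneg _
  have he := Real.exp_pos (-b)
  rw [← mul_pow] at h1
  have h3 := abs_le_of_sq_le_sq' h1 (mul_nonneg hd0 he.le)
  have hb1 : Real.exp (-b) ≤ 1 := Real.exp_le_one_iff.2 (by
    have : 0 ≤ (n : ℝ) * Real.log m / 6 := by positivity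
    linarith)
  have h4 : μA ≤ 2 * Real.exp (-b) := by
    have := h3.2
    have : l2Dist ((cycleLamp n m β ^ t) (f, x)) (cyclePi n m) * Real.exp (-b) ≤
        1 / 2 * Real.exp (-b) := mul_le_mul_of_nonneg_right (by linarith) he.le
    nlinarith
  have h6 : Real.exp (-(40 * t / (n : ℝ) ^ 2)) ≤ Real.exp (Real.log 4 - b) := by
    rw [sub_eq_add_neg, Real.exp_add, Real.exp_log (by norm_num)]
    linarith
  rw [Real.exp_le_exp] at h6
  have h7 : n * Real.log m / 6 - Real.log 4 ≤ 40 * t / (n : ℝ) ^ 2 := by linarith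
  rw [le_div_iff₀ (by positivity)] at h7
  linarith

end Arc

/-! ### Bounds for the mixing times. -/

section MixingTimes

variable {n m : ℕ} [NeZero n] [NeZero m] {β ε : ℝ}

lemma cycleLamp_transpose {n m : ℕ} [NeZero n] {β : ℝ} : (cycleLamp n m β)ᵀ = cycleLamp n m β :=
  lamplighterChain_transpose cycleWalk_transpose

lemma le_cycleLamp_pow_apply (hβ0 : 0 ≤ β) (hβ1 : β < 1) {A : ℕ} (hA : 0 < A)
    (h : ∀ u v : State (ZMod n) m,
      1 / 4 * uniform (State (ZMod n) m) v ≤ (cycleLamp n m β ^ (A * n ^ 2)) u v)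
    {k s : ℕ} (hs : k * (A * n ^ 2) ≤ s) (u v : State (ZMod n) m) :
    (1 - (3 / 4) ^ k) * uniform (State (ZMod n) m) v ≤ (cycleLamp n m β ^ s) u v := by
  have hn := NeZero.pos n
  refine le_trans (mul_le_mul_of_nonneg_right ?_ (uniform_pos v).le)
    (le_pow_apply_of_minorization_pow (cycleLamp_mem_rowStochastic hβ0 hβ1)
      cycleLamp_transpose h s u v)
  have hk : k ≤ s / (A * n ^ 2) := (Nat.le_div_iff_mul_le (by positivity)).2 hs
  have := pow_le_pow_of_le_one (a := (3 / 4 : ℝ)) (by norm_num) (by norm_num) hk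
  norm_num
  linarith

lemma card_state {n m : ℕ} [NeZero n] : (Fintype.card (State (ZMod n) m) : ℝ) = (m : ℝ) ^ n * n := by
  simp [Fintype.card_prod, ZMod.card]

lemma minMass_cyclePi : 1 / minMass (cyclePi n m) = (m : ℝ) ^ n * n := by
  have : minMass (cyclePi n m) = 1 / (Fintype.card (State (ZMod n) m) : ℝ) := ciInf_const
  rw [this, one_div_one_div, card_state]

lemma log_ge_of_two_le {m : ℕ} (hm : 2 ≤ m) : 0.69 ≤ Real.log m := by
  have h := Real.log_le_log (by norm_num) (show (2 : ℝ) ≤ m by exact_mod_cast hm)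
  linarith [Real.log_two_gt_d9]

lemma two_le_mul_log {n m : ℕ} (hn : 3 ≤ n) (hm : 2 ≤ m) : 2 ≤ (n : ℝ) * Real.log m := by
  have h1 := log_ge_of_two_le hm
  have h2 : (3 : ℝ) ≤ n := by exact_mod_cast hn
  nlinarith

lemma half_le_log_mul_log {n m : ℕ} (hn : 3 ≤ n) (hm : 2 ≤ m) :
    1 / 2 ≤ Real.log ((n : ℝ) * Real.log m) := by
  have h := Real.log_le_log (by norm_num) (two_le_mul_log hn hm)
  linarith [Real.log_two_gt_d9]

lemma log_card_state_le (hm : 2 ≤ m) :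
    Real.log ((m : ℝ) ^ n * n) ≤ 3 * (n * Real.log m) := by
  have hn0 : (0 : ℝ) < n := by exact_mod_cast NeZero.pos n
  have hm0 : (0 : ℝ) < m := by exact_mod_cast NeZero.pos m
  rw [Real.log_mul (by positivity) (by positivity), Real.log_pow]
  have h1 := log_ge_of_two_le hm
  have h2 := Real.log_le_sub_one_of_pos hn0
  nlinarith

lemma tvDist_cycleLamp_le (hβ0 : 0 ≤ β) (hβ1 : β < 1) {A : ℕ} (hA : 0 < A)
    (h : ∀ u v : State (ZMod n) m,
      1 / 4 * uniform (State (ZMod n) m) v ≤ (cycleLamp n m β ^ (A * n ^ 2)) u v)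
    {k : ℕ} (hk : (3 / 4 : ℝ) ^ k ≤ ε) (s : ℕ) (hs : k * (A * n ^ 2) ≤ s)
    (u : State (ZMod n) m) : tvDist ((cycleLamp n m β ^ s) u) (cyclePi n m) ≤ ε :=
  (tvDist_le_of_le (by positivity) (fun v => (uniform_pos v).le) sum_uniform
    (le_cycleLamp_pow_apply hβ0 hβ1 hA h hs u)).trans hk

lemma relEntropy_cycleLamp_le (hm : 2 ≤ m) (hβ0 : 0 ≤ β) (hβ1 : β < 1) {A : ℕ} (hA : 0 < A)
    (h : ∀ u v : State (ZMod n) m,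
      1 / 4 * uniform (State (ZMod n) m) v ≤ (cycleLamp n m β ^ (A * n ^ 2)) u v)
    {k : ℕ} (hk : (3 / 4 : ℝ) ^ k * (3 * (n * Real.log m)) ≤ ε) (s : ℕ)
    (hs : k * (A * n ^ 2) ≤ s) (u : State (ZMod n) m) :
    relEntropy ((cycleLamp n m β ^ s) u) (cyclePi n m) ≤ ε := by
  have hP := pow_mem_rowStochastic (cycleLamp_mem_rowStochastic (n := n) (m := m) hβ0 hβ1) s
  refine le_trans (relEntropy_uniform_le (p := (3 / 4) ^ k) (by positivity)
    (pow_le_one₀ (by norm_num) (by norm_num)) (sum_row_of_mem_rowStochastic hP u)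
    (le_cycleLamp_pow_apply hβ0 hβ1 hA h hs u)) (le_trans ?_ hk)
  rw [card_state]
  exact mul_le_mul_of_nonneg_left (log_card_state_le hm) (by positivity)

lemma l2Dist_cycleLamp_le (hβ0 : 0 ≤ β) (hβ1 : β < 1) {A : ℕ} (hA : 0 < A)
    (h : ∀ u v : State (ZMod n) m,
      1 / 4 * uniform (State (ZMod n) m) v ≤ (cycleLamp n m β ^ (A * n ^ 2)) u v)
    {k : ℕ} (hk : (Fintype.card (State (ZMod n) m) : ℝ) * (2 * (3 / 4 : ℝ) ^ k) ≤ ε) (s : ℕ)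
    (hs : k * (A * n ^ 2) ≤ s) (u : State (ZMod n) m) :
    l2Dist ((cycleLamp n m β ^ s) u) (cyclePi n m) ≤ ε :=
  have hP := pow_mem_rowStochastic (cycleLamp_mem_rowStochastic (n := n) (m := m) hβ0 hβ1) s
  (l2Dist_uniform_le (by positivity) (sum_row_of_mem_rowStochastic hP u)
    (le_cycleLamp_pow_apply hβ0 hβ1 hA h hs u)).trans hk

lemma exists_mul_pow_le (a : ℝ) (ha : 0 < a) (hε : 0 < ε) : ∃ k : ℕ, a * (3 / 4 : ℝ) ^ k ≤ ε := by
  obtain ⟨k, hk⟩ := exists_pow_lt_of_lt_one (div_pos hε ha) (show (3 / 4 : ℝ) < 1 by norm_num)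
  rw [lt_div_iff₀ ha, mul_comm] at hk
  exact ⟨k, hk.le⟩

/-- The total variation mixing time is at most of order `n²`. -/
lemma exists_tauTv_le (hβ0 : 0 ≤ β) (hβ1 : β < 1) (hε : 0 < ε) : ∃ C : ℝ, 0 < C ∧
    ∀ (n m : ℕ) [NeZero n], 2 ≤ m → (β = 0 → Odd n) →
      (tauTv n m β ε : ℝ) ≤ C * (n : ℝ) ^ 2 := by
  obtain ⟨A, hA, h⟩ := exists_minorization hβ0 hβ1
  obtain ⟨k, hk⟩ := exists_mul_pow_le 1 one_pos hε
  rw [one_mul] at hk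
  refine ⟨k * A + 1, by positivity, fun n m _ hm hodd => ?_⟩
  have : NeZero m := ⟨by omega⟩
  have h1 : tauTv n m β ε ≤ k * (A * n ^ 2) :=
    mixingTime_le (tvDist_cycleLamp_le hβ0 hβ1 hA (h n m hodd) hk)
  have h2 : (tauTv n m β ε : ℝ) ≤ k * (A * (n : ℝ) ^ 2) := by exact_mod_cast h1
  nlinarith [sq_nonneg (n : ℝ)]

lemma sq_le_tauTv (hβ0 : 0 ≤ β) (hβ1 : β < 1) (hodd : β = 0 → Odd n) (hε : 0 < ε) (hn : 3 ≤ n) :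
    (1 - 2 * ε) / 40 * (n : ℝ) ^ 2 ≤ tauTv n m β ε := by
  obtain ⟨A, hA, h⟩ := exists_minorization hβ0 hβ1
  obtain ⟨k, hk⟩ := exists_mul_pow_le 1 one_pos hε
  rw [one_mul] at hk
  exact sq_le_of_tvDist_le hβ0 hβ1 hn
    (le_of_mixingTime (tvDist_cycleLamp_le hβ0 hβ1 hA (h n m hodd) hk) (fun _ => 0, 0))

/-- The number of rounds needed for the entropy to drop below `ε`. -/
lemma exists_rounds (hε0 : 0 < ε) (hε1 : ε < 1 / 2) : ∃ B : ℝ, 0 < B ∧ ∀ X : ℝ, 0 < X →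
    1 / 2 ≤ Real.log X → ∃ k : ℕ, (3 / 4 : ℝ) ^ k * (3 * X) ≤ ε ∧ (k : ℝ) ≤ B * Real.log X := by
  have hl : 0 < Real.log (4 / 3) := Real.log_pos (by norm_num)
  have h3 : 0 < Real.log (3 / ε) := Real.log_pos (by rw [lt_div_iff₀ hε0]; linarith)
  set b := Real.log (3 / ε) / Real.log (4 / 3) with hb
  have hb0 : 0 < b := div_pos h3 hl
  -- The number of rounds is the ceiling of the solution q of (4/3)^q = 3X/ε. Its constant part b
  -- and the rounding cost 1 are absorbed through log X ≥ 1/2, whence the factor 2.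
  refine ⟨1 / Real.log (4 / 3) + 2 * (b + 1), by positivity, fun X hX hlX => ?_⟩
  set q := (Real.log X + Real.log (3 / ε)) / Real.log (4 / 3) with hq
  have hq0 : 0 ≤ q := div_nonneg (by linarith) hl.le
  refine ⟨⌈q⌉₊, ?_, ?_⟩
  · have h1 := Nat.le_ceil q
    have h1' : Real.log (X * (3 / ε)) ≤ Real.log ((4 / 3) ^ ⌈q⌉₊) := by
      rw [Real.log_mul hX.ne' (by positivity), Real.log_pow, ← div_le_iff₀ hl]
      exact h1
    have h2 := (Real.log_le_log_iff (by positivity) (by positivity)).1 h1'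
    have h4 : ((3 : ℝ) / 4) ^ ⌈q⌉₊ * (4 / 3) ^ ⌈q⌉₊ = 1 := by
      rw [← mul_pow]; norm_num
    have h5 := mul_le_mul_of_nonneg_left h2
      (show (0 : ℝ) ≤ (3 / 4) ^ ⌈q⌉₊ by positivity)
    rw [h4] at h5
    calc (3 / 4 : ℝ) ^ ⌈q⌉₊ * (3 * X) = (3 / 4 : ℝ) ^ ⌈q⌉₊ * (X * (3 / ε)) * ε := by
          field_simp
      _ ≤ 1 * ε := mul_le_mul_of_nonneg_right h5 hε0.le
      _ = ε := one_mul ε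
  · have h1 := (Nat.ceil_lt_add_one hq0).le
    have h2 : q = 1 / Real.log (4 / 3) * Real.log X + b := by
      rw [hq, hb]; ring
    nlinarith

/-- The entropy mixing time is at most of order `n² log (n log m)`. -/
lemma exists_tauEnt_le (hβ0 : 0 ≤ β) (hβ1 : β < 1) (hε0 : 0 < ε) (hε1 : ε < 1 / 2) :
    ∃ C : ℝ, 0 < C ∧ ∀ (n m : ℕ) [NeZero n], 3 ≤ n → 2 ≤ m → (β = 0 → Odd n) →
      (tauEnt n m β ε : ℝ) ≤ C * ((n : ℝ) ^ 2 * Real.log (n * Real.log m)) := by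
  obtain ⟨A, hA, h⟩ := exists_minorization hβ0 hβ1
  obtain ⟨B, hB, hk⟩ := exists_rounds hε0 hε1
  refine ⟨B * A, by positivity, fun n m _ hn hm hodd => ?_⟩
  have : NeZero m := ⟨by omega⟩
  have hX := two_le_mul_log hn hm
  obtain ⟨k, hk1, hk2⟩ := hk (n * Real.log m) (by linarith) (half_le_log_mul_log hn hm)
  have h1 : tauEnt n m β ε ≤ k * (A * n ^ 2) :=
    mixingTime_le (relEntropy_cycleLamp_le hm hβ0 hβ1 hA (h n m hodd) hk1)
  have h2 : (tauEnt n m β ε : ℝ) ≤ k * (A * (n : ℝ) ^ 2) := by exact_mod_cast h1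
  have h3 := mul_le_mul_of_nonneg_right hk2 (show (0 : ℝ) ≤ A * (n : ℝ) ^ 2 by positivity)
  linarith

lemma relEntropy_tauEnt_le (hβ0 : 0 ≤ β) (hβ1 : β < 1) (hodd : β = 0 → Odd n) (hε : 0 < ε)
    (hn : 3 ≤ n) (hm : 2 ≤ m) (u : State (ZMod n) m) :
    relEntropy ((cycleLamp n m β ^ tauEnt n m β ε) u) (cyclePi n m) ≤ ε := by
  obtain ⟨A, hA, h⟩ := exists_minorization hβ0 hβ1
  have hX := two_le_mul_log hn hm
  obtain ⟨k, hk⟩ := exists_mul_pow_le (3 * (n * Real.log m)) (by linarith) hε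
  rw [mul_comm] at hk
  exact le_of_mixingTime (relEntropy_cycleLamp_le hm hβ0 hβ1 hA (h n m hodd) hk) u

lemma l2Dist_tauTwo_le (hβ0 : 0 ≤ β) (hβ1 : β < 1) (hodd : β = 0 → Odd n) (hε : 0 < ε)
    (u : State (ZMod n) m) :
    l2Dist ((cycleLamp n m β ^ tauTwo n m β ε) u) (cyclePi n m) ≤ ε := by
  obtain ⟨A, hA, h⟩ := exists_minorization hβ0 hβ1
  have hc : (0 : ℝ) < Fintype.card (State (ZMod n) m) := Nat.cast_pos.2 Fintype.card_pos
  obtain ⟨k, hk⟩ := exists_mul_pow_le (Fintype.card (State (ZMod n) m) * 2) (by positivity) hε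
  rw [mul_assoc] at hk
  exact le_of_mixingTime (l2Dist_cycleLamp_le hβ0 hβ1 hA (h n m hodd) hk) u

/-- The untouched-lamp bound loses n² log 12, which is repaid by the position bound n² ≤ τ / ((1 -
2ε)/40). -/
lemma sq_mul_log_le_tauEnt (hβ0 : 0 ≤ β) (hβ1 : β < 1) (hodd : β = 0 → Odd n) (hε0 : 0 < ε)
    (hε1 : ε < 1 / 2) (hn : 3 ≤ n) (hm : 2 ≤ m) :
    (n : ℝ) ^ 2 * Real.log (n * Real.log m) ≤
      (40 + Real.log 12 / ((1 - 2 * ε) / 40)) * tauEnt n m β ε := by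
  have ha : 0 < (1 - 2 * ε) / 40 := by linarith
  have hl : 0 < Real.log 12 := Real.log_pos (by norm_num)
  have h := relEntropy_tauEnt_le (m := m) hβ0 hβ1 hodd hε0 hn hm
  have h1 := sq_le_of_relEntropy_le hβ0 hβ1 hn (h (fun _ => 0, 0))
  have h2 := log_le_of_relEntropy_le hn hm hβ0 hβ1 hε1 (h (fun _ => 0, _))
  have h3 := mul_le_mul_of_nonneg_left h1 (div_pos hl ha).le
  rw [← mul_assoc, div_mul_cancel₀ _ ha.ne'] at h3
  linarith

lemma sq_mul_le_tauTwo (hβ0 : 0 ≤ β) (hβ1 : β < 1) (hodd : β = 0 → Odd n) (hε0 : 0 < ε)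
    (hε1 : ε < 1 / 2) (hn : 3 ≤ n) (hm : 2 ≤ m) :
    (n : ℝ) ^ 2 * (n * Real.log m) ≤
      (6 * (40 + Real.log 4 / ((1 - 2 * ε) / 40))) * tauTwo n m β ε := by
  have ha : 0 < (1 - 2 * ε) / 40 := by linarith
  have hl : 0 < Real.log 4 := Real.log_pos (by norm_num)
  have h := l2Dist_tauTwo_le (m := m) hβ0 hβ1 hodd hε0
  have h1 := sq_le_of_l2Dist_le hβ0 hβ1 hε0 hε1 hn (h (fun _ => 0, 0))
  have h2 := log_le_of_l2Dist_le hn hm hβ0 hβ1 hε1 (h (fun _ => 0, _))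
  have h3 := mul_le_mul_of_nonneg_left h1 (div_pos hl ha).le
  rw [← mul_assoc, div_mul_cancel₀ _ ha.ne'] at h3
  linarith

lemma log_log_minMass_add_le (hε0 : 0 < ε) (hε1 : ε < 1 / 2) (hn : 3 ≤ n) (hm : 2 ≤ m) :
    Real.log (Real.log (1 / minMass (cyclePi n m))) + Real.log (1 / ε) ≤
      (1 + 2 * (Real.log 3 + Real.log (1 / ε))) * Real.log (n * Real.log m) := by
  have hX := two_le_mul_log hn hm
  have hL := half_le_log_mul_log hn hm
  have hn3 : (3 : ℝ) ≤ n := by exact_mod_cast hn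
  have hm1 : (1 : ℝ) ≤ (m : ℝ) ^ n := one_le_pow₀ (by exact_mod_cast NeZero.pos m)
  have h3 : 0 < Real.log 3 := Real.log_pos (by norm_num)
  have hε : 0 < Real.log (1 / ε) := Real.log_pos (by rw [lt_div_iff₀ hε0]; linarith)
  have h1 := Real.log_le_log (Real.log_pos (by nlinarith : (1 : ℝ) < (m : ℝ) ^ n * n))
    (log_card_state_le (n := n) hm)
  have h2 : Real.log (3 * (n * Real.log m)) = Real.log 3 + Real.log (n * Real.log m) :=
    Real.log_mul (by norm_num) (by linarith)
  rw [minMass_cyclePi]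
  nlinarith

/-- Applied to X = n log m, the first inequality separates entropy from total variation and the
second separates L² from entropy. -/
lemma exists_le_log_and_mul_log_le (R : ℝ) :
    ∃ X₀ : ℝ, ∀ X, X₀ ≤ X → R ≤ Real.log X ∧ R * Real.log X ≤ X := by
  have h1 := Real.tendsto_log_atTop.eventually_ge_atTop R
  have h2 := (Real.isLittleO_log_id_atTop.const_mul_left R).bound one_pos
  obtain ⟨X₀, h⟩ := Filter.eventually_atTop.1
    ((h1.and h2).and (Filter.eventually_ge_atTop (0 : ℝ)))
  refine ⟨X₀, fun X hX => ⟨(h X hX).1.1, ?_⟩⟩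
  have h3 := (h X hX).1.2
  rw [one_mul, id, Real.norm_of_nonneg (h X hX).2] at h3
  exact (le_abs_self _).trans h3

end MixingTimes

end

end Lamplighter

/-! ### Assembly of the constants. -/

theorem mainTheorem6 (β : ℝ) (hβ0 : 0 ≤ β) (hβ1 : β < 1) (ε : ℝ) (hε0 : 0 < ε)
    (hε1 : ε < 1 / 2) :
    -- the chain is a reversible Markov chain with uniform stationary distribution
    (∀ (n m : ℕ) [NeZero n], 3 ≤ n → 2 ≤ m →
      Lamplighter.cycleLamp n m β ∈ Matrix.rowStochastic ℝ (Lamplighter.State (ZMod n) m) ∧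
      Lamplighter.IsReversible (Lamplighter.cycleLamp n m β) (Lamplighter.cyclePi n m)) ∧
    -- orders of the three mixing times, and tightness of the iterated logarithm
    (∃ c C : ℝ, 0 < c ∧ 0 < C ∧ ∀ (n m : ℕ) [NeZero n], 3 ≤ n → 2 ≤ m → (β = 0 → Odd n) →
      (c * (n : ℝ) ^ 2 ≤ (Lamplighter.tauTv n m β ε : ℝ) ∧
        (Lamplighter.tauTv n m β ε : ℝ) ≤ C * (n : ℝ) ^ 2) ∧
      (c * ((n : ℝ) ^ 2 * Real.log ((n : ℝ) * Real.log (m : ℝ)))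
          ≤ (Lamplighter.tauEnt n m β ε : ℝ) ∧
        (Lamplighter.tauEnt n m β ε : ℝ)
          ≤ C * ((n : ℝ) ^ 2 * Real.log ((n : ℝ) * Real.log (m : ℝ)))) ∧
      c * ((n : ℝ) ^ 2 * Real.log ((m : ℝ) ^ n)) ≤ (Lamplighter.tauTwo n m β ε : ℝ) ∧
      c * ((Lamplighter.tauTv n m β (1 / (2 * Real.exp 1)) : ℝ) *
          (Real.log (Real.log (1 / Lamplighter.minMass (Lamplighter.cyclePi n m)))
            + Real.log (1 / ε)))
        ≤ (Lamplighter.tauEnt n m β ε : ℝ)) ∧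
    -- the three mixing times have different orders as `N = m ^ n` tends to infinity
    (∀ M : ℝ, ∃ K : ℝ, ∀ (n m : ℕ) [NeZero n], 3 ≤ n → 2 ≤ m → (β = 0 → Odd n) →
      K ≤ (m : ℝ) ^ n →
      M * (Lamplighter.tauTv n m β ε : ℝ) ≤ (Lamplighter.tauEnt n m β ε : ℝ) ∧
      M * (Lamplighter.tauEnt n m β ε : ℝ) ≤ (Lamplighter.tauTwo n m β ε : ℝ)) := by
  obtain ⟨C₁, hC₁, h₁⟩ := Lamplighter.exists_tauTv_le hβ0 hβ1 hε0
  obtain ⟨C₂, hC₂, h₂⟩ := Lamplighter.exists_tauEnt_le hβ0 hβ1 hε0 hε1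
  obtain ⟨C₃, hC₃, h₃⟩ := Lamplighter.exists_tauTv_le hβ0 hβ1
    (show 0 < 1 / (2 * Real.exp 1) by positivity)
  set a := (1 - 2 * ε) / 40 with ha
  have ha0 : 0 < a := by rw [ha]; linarith
  set D₂ := 40 + Real.log 12 / a with hD₂
  set D₃ := 6 * (40 + Real.log 4 / a) with hD₃
  have hD₂0 : 0 < D₂ := by
    have : 0 < Real.log 12 := Real.log_pos (by norm_num)
    positivity
  have hD₃0 : 0 < D₃ := by
    have : 0 < Real.log 4 := Real.log_pos (by norm_num)
    positivity
  set E := 1 + 2 * (Real.log 3 + Real.log (1 / ε)) with hE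
  have hE0 : 0 < E := by
    have h3 : 0 < Real.log 3 := Real.log_pos (by norm_num)
    have : 0 < Real.log (1 / ε) := Real.log_pos (by rw [lt_div_iff₀ hε0]; linarith)
    positivity
  have hscale : ∀ {c d x y : ℝ}, 0 < d → 0 ≤ y → c ≤ d⁻¹ → x ≤ d * y → 0 ≤ x → c * x ≤ y := by
    intro c d x y hd _ hc hx hx0
    calc c * x ≤ d⁻¹ * x := mul_le_mul_of_nonneg_right hc hx0
      _ ≤ d⁻¹ * (d * y) := mul_le_mul_of_nonneg_left hx (inv_nonneg.2 hd.le)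
      _ = y := by field_simp
  refine ⟨fun n m _ hn hm => ?_, ?_, fun M => ?_⟩
  · have : NeZero m := ⟨by omega⟩
    refine ⟨Lamplighter.cycleLamp_mem_rowStochastic hβ0 hβ1, fun x y => ?_⟩
    have h := congrFun (congrFun
      (Lamplighter.cycleLamp_transpose (n := n) (m := m) (β := β)) y) x
    rw [Matrix.transpose_apply] at h
    rw [h]
    rfl
  · refine ⟨min (min a D₂⁻¹) (min D₃⁻¹ (C₃ * E * D₂)⁻¹), max C₁ C₂, by positivity,
      by positivity, fun n m _ hn hm hodd => ?_⟩
    have : NeZero m := ⟨by omega⟩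
    have hlog := Lamplighter.half_le_log_mul_log hn hm
    have hlogm := Lamplighter.log_ge_of_two_le hm
    have hsq : (0 : ℝ) ≤ (n : ℝ) ^ 2 := sq_nonneg _
    have hX := Lamplighter.two_le_mul_log hn hm
    have e₂ := Lamplighter.sq_mul_log_le_tauEnt (m := m) hβ0 hβ1 hodd hε0 hε1 hn hm
    have e₃ := Lamplighter.sq_mul_le_tauTwo (m := m) hβ0 hβ1 hodd hε0 hε1 hn hm
    rw [← ha] at e₂ e₃
    rw [← hD₂] at e₂
    rw [← hD₃] at e₃
    have hn2 : 0 ≤ (n : ℝ) ^ 2 * Real.log (n * Real.log m) := mul_nonneg hsq (by linarith)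
    refine ⟨⟨?_, ?_⟩, ⟨?_, ?_⟩, ?_, ?_⟩
    · exact (mul_le_mul_of_nonneg_right ((min_le_left _ _).trans (min_le_left _ _)) hsq).trans
        (Lamplighter.sq_le_tauTv hβ0 hβ1 hodd hε0 hn)
    · exact (h₁ n m hm hodd).trans (mul_le_mul_of_nonneg_right (le_max_left _ _) hsq)
    · exact hscale hD₂0 (Nat.cast_nonneg _) ((min_le_left _ _).trans (min_le_right _ _)) e₂ hn2
    · exact (h₂ n m hn hm hodd).trans (mul_le_mul_of_nonneg_right (le_max_right _ _) hn2)
    · rw [Real.log_pow]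
      exact hscale hD₃0 (Nat.cast_nonneg _) ((min_le_right _ _).trans (min_le_left _ _)) e₃
        (mul_nonneg hsq (by linarith))
    -- Chain τ ≤ C₃ n², then log log (1/π_*) + log (1/ε) ≤ E log (n log m), then n² log (n log m) ≤
    -- D₂ τ_ent; this explains the entry `(C₃ * E * D₂)⁻¹` in the minimum.
    · set τ : ℝ := (Lamplighter.tauTv n m β (1 / (2 * Real.exp 1)) : ℝ) with hτ
      have hτ0 : 0 ≤ τ := Nat.cast_nonneg _
      have g₁ := mul_le_mul_of_nonneg_left
        (Lamplighter.log_log_minMass_add_le (n := n) (m := m) hε0 hε1 hn hm) hτ0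
      rw [← hE] at g₁
      have g₂ := mul_le_mul_of_nonneg_right (h₃ n m hm hodd)
        (show 0 ≤ E * Real.log (n * Real.log m) from mul_nonneg hE0.le (by linarith))
      rw [← hτ] at g₂
      have g₃ := mul_le_mul_of_nonneg_left e₂ (mul_pos hC₃ hE0).le
      have hc0 : 0 < min (min a D₂⁻¹) (min D₃⁻¹ (C₃ * E * D₂)⁻¹) := by positivity
      refine (mul_le_mul_of_nonneg_left (g₁.trans g₂) hc0.le).trans ?_
      refine hscale (d := C₃ * E * D₂) (by positivity) (Nat.cast_nonneg _)
        ((min_le_right _ _).trans (min_le_right _ _)) ?_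
        (mul_nonneg (by positivity) (mul_nonneg hE0.le (by linarith)))
      linarith
  · obtain ⟨X₀, hX₀⟩ := Lamplighter.exists_le_log_and_mul_log_le
      (max (|M| * C₁ * D₂) (|M| * C₂ * D₃))
    -- The threshold m^n ≥ exp X₀ says exactly that n log m ≥ X₀.
    refine ⟨Real.exp X₀, fun n m _ hn hm hodd hK => ?_⟩
    have : NeZero m := ⟨by omega⟩
    have hlog := Lamplighter.half_le_log_mul_log hn hm
    have hsq : (0 : ℝ) ≤ (n : ℝ) ^ 2 := sq_nonneg _
    have hX : X₀ ≤ n * Real.log m := by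
      rw [← Real.log_pow, Real.le_log_iff_exp_le (by
        have : (0 : ℝ) < m := by exact_mod_cast NeZero.pos m
        positivity)]
      exact hK
    obtain ⟨k₁, k₂⟩ := hX₀ _ hX
    have e₂ := Lamplighter.sq_mul_log_le_tauEnt (m := m) hβ0 hβ1 hodd hε0 hε1 hn hm
    have e₃ := Lamplighter.sq_mul_le_tauTwo (m := m) hβ0 hβ1 hodd hε0 hε1 hn hm
    rw [← ha] at e₂ e₃
    rw [← hD₂] at e₂
    rw [← hD₃] at e₃
    have hMle : ∀ {x : ℝ}, 0 ≤ x → M * x ≤ |M| * x := fun hx =>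
      mul_le_mul_of_nonneg_right (le_abs_self M) hx
    constructor
    · have g₁ := mul_le_mul_of_nonneg_left (h₁ n m hm hodd) (abs_nonneg M)
      have g₂ := mul_le_mul_of_nonneg_left ((le_max_left _ _).trans k₁) hsq
      refine (hMle (Nat.cast_nonneg _)).trans (g₁.trans ?_)
      refine le_of_mul_le_mul_left ?_ hD₂0
      linarith
    · have g₁ := mul_le_mul_of_nonneg_left (h₂ n m hn hm hodd) (abs_nonneg M)
      have g₂ := mul_le_mul_of_nonneg_left
        ((mul_le_mul_of_nonneg_right (le_max_right _ _) (by linarith)).trans k₂) hsq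
      refine (hMle (Nat.cast_nonneg _)).trans (g₁.trans ?_)
      refine le_of_mul_le_mul_left ?_ hD₃0
      linarith
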